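/- **Setting.** Let $\mathcal P(\mathbb N_0)$ be the set of probability measures on $\mathbb N_0=\{0,1,2,\dots\}$. For $F\in\mathcal P(\mathbb N_0)$ put $\overline F=\sum_k kF[k]$ and $\tilde F=\overline F^{-2}\sum_k k(k-1)F[k]$. Let $\xi=(F_k)_{k\in\mathbb Z}$ be i.i.d. random elements of $\mathcal P(\mathbb N_0)$, and let $\mu$ be a probability measure on $\mathbb Z$. Given $\xi$, a branching random walk starts from one particle at position $0$; for every $k\ge 1$ each particle of generation $k-1$ independently produces a number of children with law $F_k$, and each child is displaced from its parent by an independent jump with law $\mu$. Let $M$ be the supremum of the positions of all particles that ever live, and let $\mathbb P$ be the annealed law (averaged over $\xi$), with expectation $\mathbb E$. Put $X_k=\log\overline F_k$, $\eta_k=\tilde F_k\in[0,\infty]$, $$\Lambda_e(\rho)=\log\mathbb E\big[e^{\rho X_1}\big],\qquad \Lambda_s(\lambda)=\log\int e^{\lambda h}\,\mu(dh),\qquad \alpha=\sup\{\rho\ge 0:\Lambda_e(\rho)\le 0\}\in[0,\infty],$$ and $\log_+y=\log\max\{y,1\}$. **Assumptions.** (i) $X_1$ is a.s. finite, $\mathbb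 E[X_1]\in(-\infty,0)$ and $\Lambda_e(\rho)<\infty$ for all $\rho\ge0$. (ii) $\mu$ is not a point mass, $\mu([2,\infty))=0$, and $\mu$ has mean $0$. **Theorem.** Assume (i), (ii) and $\alpha>1$. Then $\Lambda_e(1)<0$. Let $\lambda_1>0$ be the positive solution of $\Lambda_e(1)+\Lambda_s(\lambda_1)=0$, and assume that $$\varTheta(1):=\Lambda_e'(1)+\Lambda_s(\lambda_1)-\lambda_1\Lambda_s'(\lambda_1)<0,\qquad \mathbb E\big[e^{X_1-\Lambda_e(1)}\log_+\eta_1\big]<\infty.$$ Then there is a constant $C_1\in(0,1]$ such that, as $x\to\infty$ through the integers, $$\lim_{x\to\infty}e^{\lambda_1x}\,\mathbb P(M\ge x)=C_1.$$ -/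

import Mathlib

open MeasureTheory ProbabilityTheory Filter Topology
open scoped ENNReal

namespace BRWRE

/-! ### Offspring laws -/

/-- An offspring law: a probability measure on `{0, 1, 2, …}`.  The σ-algebra on this type is the
one generated by the evaluations `F ↦ F A`, which for laws on a countable set is the Borel
σ-algebra of the total variation distance. -/
abbrev OffspringLaw : Type := ProbabilityMeasure ℕ

/-- The mean `∑ k F[k]` of an offspring law, with values in `[0, ∞]`. -/
noncomputable def offspringMean (F : OffspringLaw) : ℝ≥0∞ :=
  ∑' k : ℕ, (k : ℝ≥0∞) * (F : Measure ℕ) {k}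

/-- `X = log (mean of F)`.  It is only used for laws whose mean is in `(0, ∞)`. -/
noncomputable def logMean (F : OffspringLaw) : ℝ := Real.log (offspringMean F).toReal

/-- `η`, the normalized second factorial moment `(∑ k (k - 1) F[k]) / (∑ k F[k])²`,
with values in `[0, ∞]`. -/
noncomputable def factorialMoment (F : OffspringLaw) : ℝ≥0∞ :=
  (∑' k : ℕ, ((k * (k - 1) : ℕ) : ℝ≥0∞) * (F : Measure ℕ) {k}) / offspringMean F ^ 2

/-- `log₊ y = log (max y 1)` for `y ∈ [0, ∞]`, with `log₊ ∞ = ∞`. -/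
noncomputable def logPlus (y : ℝ≥0∞) : ℝ≥0∞ := (ENNReal.log (max y 1)).toENNReal

/-! ### The environment -/

/-- Environments: two-sided sequences of offspring laws `(F_k)`, `k ∈ ℤ`. -/
abbrev Env : Type := ℤ → OffspringLaw

/-- The law `P_E` of the random environment: the `F_k` are i.i.d. with common law `E`. -/
noncomputable def envLaw (E : Measure OffspringLaw) [IsProbabilityMeasure E] : Measure Env :=
  Measure.infinitePi (fun _ : ℤ => E)

instance (E : Measure OffspringLaw) [IsProbabilityMeasure E] :
    IsProbabilityMeasure (envLaw E) := by
  unfold envLaw; infer_instance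

/-- `Λ_e(ρ) = log E[e^{ρ X}]`. -/
noncomputable def LamE (E : Measure OffspringLaw) (ρ : ℝ) : ℝ := cgf logMean E ρ

/-- `α = sup {ρ ≥ 0 : Λ_e(ρ) ≤ 0}`, possibly `∞`. -/
noncomputable def alpha (E : Measure OffspringLaw) : EReal :=
  sSup ((fun ρ : ℝ => (ρ : EReal)) '' {ρ : ℝ | 0 ≤ ρ ∧ LamE E ρ ≤ 0})

/-- Subcriticality: `X` is almost surely well defined and finite, `E[X] ∈ (-∞, 0)`, and
`Λ_e(ρ) < ∞` for every `ρ ≥ 0`. -/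
structure Subcritical (E : Measure OffspringLaw) : Prop where
  mean_pos_finite : ∀ᵐ F ∂E, 0 < offspringMean F ∧ offspringMean F < ∞
  integrable_logMean : Integrable logMean E
  integral_logMean_neg : ∫ F, logMean F ∂E < 0
  integrable_exp : ∀ ρ : ℝ, 0 ≤ ρ → Integrable (fun F => Real.exp (ρ * logMean F)) E

/-! ### The jumps -/

/-- `Λ_s(l) = log E_μ[e^{l h}]`. -/
noncomputable def LamS (μ : Measure ℤ) (l : ℝ) : ℝ := cgf (fun h : ℤ => (h : ℝ)) μ l

/-- The jump law on `ℤ` does not charge `[2, ∞)`, is non-trivial, and has mean `0`. -/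
structure JumpAssumption (μ : Measure ℤ) : Prop where
  no_big_jump : μ (Set.Ici 2) = 0
  nontrivial : ∀ c : ℤ, μ ≠ Measure.dirac c
  integrable : Integrable (fun h : ℤ => (h : ℝ)) μ
  mean_zero : ∫ h : ℤ, (h : ℝ) ∂μ = 0

/-- `Θ(1) = Λ_e'(1) + Λ_s(l) - l Λ_s'(l)`, to be used with `l = λ₁`. -/
noncomputable def theta1 (E : Measure OffspringLaw) (μ : Measure ℤ) (l : ℝ) : ℝ :=
  deriv (LamE E) 1 + LamS μ l - l * deriv (LamS μ) l

/-! ### The branching random walk -/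

/-- Potential particles (Ulam–Harris labels).  The label `[i₁, …, iₙ]` is the `iₙ`-th child
of … of the `i₁`-th child of the root `[]`; children are numbered from `0`. -/
abbrev Node : Type := List ℕ

/-- The reproduction data of all potential particles: particle `u` has `(ω u).1` children, and
its child number `i` is displaced by `(ω u).2 i` from `u`. -/
abbrev Marks : Type := Node → ℕ × (ℕ → ℤ)

/-- The genealogical tree: every ancestor `u.take k` has more than `u[k]` children. -/
def tree (ω : Marks) : Set Node :=
  {u | ∀ k : Fin u.length, u[k] < (ω (u.take k)).1}

/-- The position of a particle: the sum of the displacements along its ancestral line. -/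
def position (ω : Marks) (u : Node) : ℤ :=
  ∑ k : Fin u.length, (ω (u.take k)).2 u[k]

/-- `M_n`, the maximal position in generation `n` (`-∞` if the generation is empty). -/
noncomputable def maxGen (ω : Marks) (n : ℕ) : EReal :=
  ⨆ u ∈ {u : Node | u ∈ tree ω ∧ u.length = n}, ((position ω u : ℝ) : EReal)

/-- `M = sup_n M_n`, the maximal displacement. -/
noncomputable def maxDisp (ω : Marks) : EReal := ⨆ n : ℕ, maxGen ω n

/-- The law of the reproduction data of `u` in the environment `ξ`: the number of children has
law `F_{|u|+1}`, and the displacements are i.i.d. with law `μ`, independent of that number. -/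
noncomputable def nodeLaw (μ : Measure ℤ) [IsProbabilityMeasure μ] (ξ : Env) (u : Node) :
    Measure (ℕ × (ℕ → ℤ)) :=
  (ξ ((u.length : ℤ) + 1) : Measure ℕ).prod (Measure.infinitePi (fun _ : ℕ => μ))

instance (μ : Measure ℤ) [IsProbabilityMeasure μ] (ξ : Env) (u : Node) :
    IsProbabilityMeasure (nodeLaw μ ξ u) := by
  unfold nodeLaw; infer_instance

/-- The quenched law `P_ξ`: the reproduction data of different particles are independent. -/
noncomputable def quenched (μ : Measure ℤ) [IsProbabilityMeasure μ] (ξ : Env) : Measure Marks :=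
  Measure.infinitePi (nodeLaw μ ξ)

instance (μ : Measure ℤ) [IsProbabilityMeasure μ] (ξ : Env) :
    IsProbabilityMeasure (quenched μ ξ) := by
  unfold quenched; infer_instance

theorem measurable_nodeLaw (μ : Measure ℤ) [IsProbabilityMeasure μ] (u : Node) :
    Measurable (fun ξ : Env => nodeLaw μ ξ u) := by
  let ν : ProbabilityMeasure (ℕ → ℤ) := ⟨Measure.infinitePi (fun _ : ℕ => μ), inferInstance⟩
  have h := (ProbabilityMeasure.measurable_fun_prod (α := ℕ) (β := ℕ → ℤ)).comp
    ((measurable_pi_apply (X := fun _ : ℤ => OffspringLaw) ((u.length : ℤ) + 1)).prodMk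
      (measurable_const (a := ν)))
  exact h

theorem measurable_quenched (μ : Measure ℤ) [IsProbabilityMeasure μ] :
    Measurable (quenched μ) := by
  refine Measurable.measure_of_isPiSystem_of_isProbabilityMeasure
    (generateFrom_squareCylinders (α := fun _ : Node => ℕ × (ℕ → ℤ))).symm
    (isPiSystem_squareCylinders (fun _ => MeasurableSpace.isPiSystem_measurableSet)
      (fun _ => by simp)) ?_
  rintro _ ⟨s, t, ht, rfl⟩
  have ht' : ∀ i, MeasurableSet (t i) := fun i => ht i (Set.mem_univ i)
  simp only [quenched]
  simp_rw [Measure.infinitePi_pi _ (fun i _ => ht' i)]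
  exact Finset.measurable_prod _ fun i _ =>
    (Measure.measurable_coe (ht' i)).comp (measurable_nodeLaw μ i)

/-- The quenched laws as a probability kernel from environments to branching random walks. -/
noncomputable def quenchedKernel (μ : Measure ℤ) [IsProbabilityMeasure μ] : Kernel Env Marks where
  toFun := quenched μ
  measurable' := measurable_quenched μ

instance (μ : Measure ℤ) [IsProbabilityMeasure μ] : IsMarkovKernel (quenchedKernel μ) :=
  ⟨fun ξ => inferInstanceAs (IsProbabilityMeasure (quenched μ ξ))⟩

/-- The annealed law `P_ξ(dω) P_E(dξ)` of the environment and the branching random walk. -/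
noncomputable def annealed (E : Measure OffspringLaw) [IsProbabilityMeasure E]
    (μ : Measure ℤ) [IsProbabilityMeasure μ] : Measure (Env × Marks) :=
  (envLaw E).compProd (quenchedKernel μ)

instance (E : Measure OffspringLaw) [IsProbabilityMeasure E]
    (μ : Measure ℤ) [IsProbabilityMeasure μ] : IsProbabilityMeasure (annealed E μ) := by
  unfold annealed; infer_instance

end BRWRE

/-!
Write `Z_x` for the number of particles that are the first on their line of descent to reach level
`x`.  As no jump exceeds `1`, they sit exactly at `x`, and biasing environment and jumps by
`e^{X - Λ_e(1)}` and `e^{λ₁ h - Λ_s(λ₁)}` gives `E[Z_x] = e^{-λ₁ x}`, because the biased walk drifts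
upwards and reaches every level (`tsum_firstPassage`).

*Existence of the limit.*  A line of descent that reaches `x + 1` passes through level `1`, the
environment after that passage is fresh, and a union bound over `Z_1` gives
`P(M ≥ x + 1) ≤ e^{-λ₁} P(M ≥ x)`.  Hence `e^{λ₁ x} P(M ≥ x)` is nonincreasing and at most `1`; this
is proved as a maximum principle, `lintegral_normHit_le_iSup`.

*Positivity of the limit.*  The quenched hitting probability `u` satisfies the recursion of the
branching process (`hitProb_succ`).  If the offspring law has mean `m` and normalized second
factorial moment `η`, then one generation of branching keeps at least a fraction `(1 + η v)⁻²` of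
the first moment, `v ≥ u` being the quenched expected number of hits (`le_normHit_succ`).  Iterating,
`E[e^{λ₁ x} u]` is at least the expectation, under the biased law, of the product of
these factors along the walk up to its first passage.  This product is bounded below on the event
that `η v` is at most a threshold `b_j`, summable in `j`, at the `j`-th vertex before the end, for
every `j` (`sum_goodHits_le_normHit`).  The exceptional events have small total probability,
uniformly in `x`: the Green function of the biased walk is bounded (`potential_le`), so that it
suffices to sum over the lengths `j` and heights of the last pieces of the path.  There `η` exceeds
`e^{c j}` with summable probabilities since `log₊ η` has a finite biased mean, and `v` exceeds
`e^{-2 c j}` with summable probabilities by Markov's inequality for a small moment `v ^ θ`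
(`lintegral_envWeight_mul_rpow_le`): this moment decreases like
`e^{j g(θ)}` with `g(0) = 0` and `g'(0) = Θ(1) < 0` (`exists_fractional_exponent`).

Everything is expressed through recursions in the number of generations with values in `[0, ∞]`.
-/

open MeasureTheory ProbabilityTheory Filter Topology
open scoped ENNReal

namespace BRWRE

section
/-! ### Splitting infinite products -/

/-- In a product measure, one coordinate and a family of other coordinates are independent. -/
theorem infinitePi_map_split {ι κ : Type*} {Ω : ι → Type*} {mΩ : ∀ i, MeasurableSpace (Ω i)}
    (P : ∀ i, Measure (Ω i)) [∀ i, IsProbabilityMeasure (P i)] (i₀ : ι) {f : κ → ι}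
    (hf : Function.Injective f) (h₀ : ∀ k, f k ≠ i₀) :
    (Measure.infinitePi P).map (fun ω => (ω i₀, fun k => ω (f k))) =
      (P i₀).prod (Measure.infinitePi fun k => P (f k)) := by
  have hind : IndepFun (fun ω : ∀ i, Ω i => ω i₀) (fun ω k => ω (f k)) (Measure.infinitePi P) := by
    have h1 := (iIndepFun_infinitePi (P := P) (X := fun _ ω => ω) (by fun_prop)).iIndep
    have h2 := indep_iSup_of_disjoint (S := {i₀}) (T := Set.range f)
      (fun i => (measurable_pi_apply i).comap_le) h1
      (by rw [Set.disjoint_singleton_left]; rintro ⟨k, hk⟩; exact h₀ k hk)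
    rw [IndepFun_iff_Indep]
    refine indep_of_indep_of_le_left (indep_of_indep_of_le_right h2 ?_) ?_
    · rw [MeasurableSpace.pi, MeasurableSpace.comap_iSup]
      refine iSup_le fun k => ?_
      rw [MeasurableSpace.comap_comp]
      exact le_iSup₂_of_le (f k) ⟨k, rfl⟩ le_rfl
    · exact le_iSup₂_of_le i₀ rfl le_rfl
  rw [(indepFun_iff_map_prod_eq_prod_map_map (measurable_pi_apply i₀).aemeasurable
    (measurable_pi_lambda _ fun k => measurable_pi_apply (f k)).aemeasurable).1 hind,
    Measure.map_infinitePi_infinitePi_of_inj hf]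
  congr 1
  exact Measure.infinitePi_map_eval P i₀

/-- One-sided environments; coordinate `k` is the law of the children of generation `k`. -/
abbrev FutureEnv : Type := ℕ → OffspringLaw

/-- The shift of a one-sided environment. -/
def shift (e : FutureEnv) : FutureEnv := fun k => e (k + 1)

@[fun_prop]
theorem measurable_shift : Measurable shift := by unfold shift; fun_prop

/-- The law of an i.i.d. one-sided environment. -/
noncomputable def futureLaw (E : Measure OffspringLaw) [IsProbabilityMeasure E] : Measure FutureEnv :=
  Measure.infinitePi fun _ => E

instance (E : Measure OffspringLaw) [IsProbabilityMeasure E] :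
    IsProbabilityMeasure (futureLaw E) := by
  unfold futureLaw; infer_instance

/-- In an i.i.d. environment the first offspring law is independent of the shifted environment, which
is again i.i.d. -/
theorem lintegral_env_split (E : Measure OffspringLaw) [IsProbabilityMeasure E]
    {g : OffspringLaw → ℝ≥0∞} {H : FutureEnv → ℝ≥0∞} (hg : Measurable g) (hH : Measurable H) :
    ∫⁻ e, g (e 0) * H (shift e) ∂futureLaw E = (∫⁻ F, g F ∂E) * ∫⁻ e, H e ∂futureLaw E := by
  have h := infinitePi_map_split (fun _ : ℕ => E) 0 (f := Nat.succ) Nat.succ_injective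
    (fun k => Nat.succ_ne_zero k)
  rw [futureLaw, ← lintegral_prod_mul hg.aemeasurable hH.aemeasurable, ← h,
    lintegral_map (by fun_prop) (by fun_prop)]
  rfl

theorem ae_env_of_ae {E : Measure OffspringLaw} [IsProbabilityMeasure E] {p : OffspringLaw → Prop}
    (h : ∀ᵐ F ∂E, p F) : ∀ᵐ e ∂futureLaw E, ∀ k, p (e k) := by
  rw [ae_all_iff]
  intro k
  have := Measure.infinitePi_map_eval (fun _ : ℕ => E) k
  rw [← this] at h
  exact ae_of_ae_map (f := fun e : ℕ → OffspringLaw => e k) (measurable_pi_apply k).aemeasurable h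

/-! ### The branching property -/

/-- The quenched law of the branching random walk in a one-sided environment. -/
noncomputable def treeLaw (μ : Measure ℤ) [IsProbabilityMeasure μ] (e : FutureEnv) : Measure Marks :=
  Measure.infinitePi fun u : Node =>
    (e u.length : Measure ℕ).prod (Measure.infinitePi fun _ : ℕ => μ)

instance (μ : Measure ℤ) [IsProbabilityMeasure μ] (e : FutureEnv) :
    IsProbabilityMeasure (treeLaw μ e) := by
  unfold treeLaw; infer_instance

/-- Some particle of generation at most `N` has position at least `y`. -/
def hit (N : ℕ) (y : ℤ) : Set Marks :=
  {ω | ∃ u ∈ tree ω, u.length ≤ N ∧ y ≤ position ω u}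

/-- The reproduction data of the descendants of the `i`-th child of the root. -/
def subMarks (ω : Marks) (i : ℕ) : Marks := fun v => ω (i :: v)

theorem nil_mem_tree (ω : Marks) : [] ∈ tree ω := fun k => k.elim0

theorem cons_mem_tree (ω : Marks) (i : ℕ) (v : Node) :
    i :: v ∈ tree ω ↔ i < (ω []).1 ∧ v ∈ tree (subMarks ω i) := by
  simp only [tree, Set.mem_ofPred_eq, subMarks]
  exact Fin.forall_fin_succ (n := v.length)
    (P := fun k => (i :: v)[k] < (ω ((i :: v).take k)).1)

theorem position_nil (ω : Marks) : position ω [] = 0 := rfl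

theorem position_cons (ω : Marks) (i : ℕ) (v : Node) :
    position ω (i :: v) = (ω []).2 i + position (subMarks ω i) v := by
  simp only [position, subMarks]
  exact Fin.sum_univ_succ (n := v.length) (fun k => (ω ((i :: v).take k)).2 (i :: v)[k])

theorem measurableSet_mem_tree (u : Node) : MeasurableSet {ω | u ∈ tree ω} := by
  simp only [tree, Set.mem_ofPred_eq, Set.ofPred_forall]
  refine MeasurableSet.iInter fun k => ?_
  exact measurableSet_lt measurable_const (by fun_prop)

theorem measurable_position (u : Node) : Measurable fun ω => position ω u := by
  unfold position; fun_prop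

theorem measurableSet_hit (N : ℕ) (y : ℤ) : MeasurableSet (hit N y) := by
  have : hit N y = ⋃ u : Node, {ω | u ∈ tree ω} ∩ {ω | u.length ≤ N ∧ y ≤ position ω u} := by
    ext ω; simp [hit]
  rw [this]
  refine MeasurableSet.iUnion fun u => (measurableSet_mem_tree u).inter ?_
  exact (MeasurableSet.const _).inter (measurableSet_le measurable_const (measurable_position u))

theorem hit_of_nonpos (N : ℕ) {y : ℤ} (hy : y ≤ 0) : hit N y = Set.univ :=
  Set.eq_univ_of_forall fun ω => ⟨[], nil_mem_tree ω, Nat.zero_le _, hy⟩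

theorem hit_zero_of_pos {y : ℤ} (hy : 0 < y) : hit 0 y = ∅ := by
  refine Set.eq_empty_of_forall_notMem ?_
  rintro ω ⟨u, -, hu, hp⟩
  rw [List.length_eq_zero_iff.1 (Nat.le_zero.1 hu), position_nil] at hp
  omega

theorem mem_hit_succ (N : ℕ) {y : ℤ} (hy : 0 < y) (ω : Marks) :
    ω ∈ hit (N + 1) y ↔ ∃ i < (ω []).1, subMarks ω i ∈ hit N (y - (ω []).2 i) := by
  constructor
  · rintro ⟨u, hu, hl, hp⟩
    cases u with
    | nil => rw [position_nil] at hp; omega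
    | cons i v =>
      rw [cons_mem_tree] at hu
      rw [position_cons] at hp
      exact ⟨i, hu.1, v, hu.2, by simpa using hl, by omega⟩
  · rintro ⟨i, hi, v, hv, hl, hp⟩
    exact ⟨i :: v, (cons_mem_tree _ _ _).2 ⟨hi, hv⟩, by simpa using hl,
      by rw [position_cons]; omega⟩

theorem hit_mono {N N' : ℕ} (h : N ≤ N') (y : ℤ) : hit N y ⊆ hit N' y :=
  fun _ ⟨u, hu, hl, hp⟩ => ⟨u, hu, hl.trans h, hp⟩

/-- The reproduction data of the root and of the subtrees of its children are independent, and the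
latter are distributed as the whole tree in the shifted environment. -/
theorem treeLaw_map_split (μ : Measure ℤ) [IsProbabilityMeasure μ] (e : FutureEnv) :
    (treeLaw μ e).map (fun ω => (ω [], subMarks ω)) =
      ((e 0 : Measure ℕ).prod (Measure.infinitePi fun _ : ℕ => μ)).prod
        (Measure.infinitePi fun _ : ℕ => treeLaw μ (shift e)) := by
  have h := infinitePi_map_split (fun u : Node =>
    (e u.length : Measure ℕ).prod (Measure.infinitePi fun _ : ℕ => μ)) []
    (f := fun p : ℕ × Node => p.1 :: p.2) (fun p q hpq => by
      simp only [List.cons.injEq] at hpq; exact Prod.ext hpq.1 hpq.2) (fun p => by simp)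
  have h2 := Measure.infinitePi_map_curry (fun (_ : ℕ) (v : Node) =>
    (e (v.length + 1) : Measure ℕ).prod (Measure.infinitePi fun _ : ℕ => μ))
  calc (treeLaw μ e).map (fun ω => (ω [], subMarks ω))
      = ((treeLaw μ e).map (fun ω => (ω [], fun p : ℕ × Node => ω (p.1 :: p.2)))).map
          (Prod.map id (MeasurableEquiv.curry ℕ Node (ℕ × (ℕ → ℤ)))) := by
        rw [Measure.map_map (by fun_prop) (by fun_prop)]; rfl
    _ = _ := by
        unfold treeLaw
        rw [h, ← Measure.map_prod_map _ _ measurable_id (by fun_prop), Measure.map_id]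
        congr 1

/-- The probability that no particle of the first `N` generations has position at least `y`,
through its recursion: the displaced subtrees of the children of the root all have to miss. -/
noncomputable def noHit (μ : Measure ℤ) : ℕ → FutureEnv → ℤ → ℝ≥0∞
  | 0, _, y => if y ≤ 0 then 0 else 1
  | N + 1, e, y => if y ≤ 0 then 0 else
      ∫⁻ k, (∫⁻ h, noHit μ N (shift e) (y - h) ∂μ) ^ k ∂(e 0 : Measure ℕ)

theorem treeLaw_hit_compl (μ : Measure ℤ) [IsProbabilityMeasure μ] (N : ℕ) (e : FutureEnv) (y : ℤ) :
    treeLaw μ e (hit N y)ᶜ = noHit μ N e y := by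
  induction N generalizing e y with
  | zero =>
    by_cases hy : y ≤ 0
    · simp [noHit, hy, hit_of_nonpos]
    · simp [noHit, hy, hit_zero_of_pos (not_le.1 hy)]
  | succ N ih =>
    by_cases hy : y ≤ 0
    · simp [noHit, hy, hit_of_nonpos]
    have hy' := not_le.1 hy
    simp only [noHit, hy, if_false]
    set S : Set ((ℕ × (ℕ → ℤ)) × (ℕ → Marks)) :=
      {p | ∀ i, i < p.1.1 → p.2 i ∉ hit N (y - p.1.2 i)} with hS
    have hSm : MeasurableSet S := by
      simp only [hS, Set.ofPred_forall]
      refine MeasurableSet.iInter fun i => ?_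
      have h1 : MeasurableSet {p : (ℕ × (ℕ → ℤ)) × (ℕ → Marks) | i < p.1.1} :=
        measurableSet_lt measurable_const (by fun_prop)
      have h2 : MeasurableSet {p : (ℕ × (ℕ → ℤ)) × (ℕ → Marks) |
          p.2 i ∉ hit N (y - p.1.2 i)} := by
        have h3 : MeasurableSet {q : ℤ × Marks | q.2 ∉ hit N (y - q.1)} := by
          have : {q : ℤ × Marks | q.2 ∉ hit N (y - q.1)} =
              ⋃ z : ℤ, {z} ×ˢ (hit N (y - z))ᶜ := by
            ext ⟨a, b⟩; simp
          rw [this]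
          exact MeasurableSet.iUnion fun z =>
            (measurableSet_singleton z).prod (measurableSet_hit _ _).compl
        exact h3.preimage (f := fun p : (ℕ × (ℕ → ℤ)) × (ℕ → Marks) => (p.1.2 i, p.2 i))
          (by fun_prop)
      exact h1.imp h2
    have hpre : (hit (N + 1) y)ᶜ = (fun ω : Marks => (ω [], subMarks ω)) ⁻¹' S := by
      ext ω
      simp [mem_hit_succ N hy', hS]
    have hm : Measurable fun ω : Marks => (ω [], subMarks ω) := by
      unfold subMarks; fun_prop
    rw [hpre, ← Measure.map_apply hm hSm, treeLaw_map_split, Measure.prod_apply hSm]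
    have hin : ∀ r : ℕ × (ℕ → ℤ),
        (Measure.infinitePi fun _ : ℕ => treeLaw μ (shift e)) (Prod.mk r ⁻¹' S) =
          ∏ i ∈ Finset.range r.1, noHit μ N (shift e) (y - r.2 i) := by
      intro r
      have : Prod.mk r ⁻¹' S =
          Set.pi (Finset.range r.1 : Finset ℕ) fun i => (hit N (y - r.2 i))ᶜ := by
        ext w; simp [hS, Set.mem_pi]
      rw [this, Measure.infinitePi_pi _ fun i _ => (measurableSet_hit _ _).compl]
      simp_rw [ih]
    have hX : Measurable fun z : ℤ => noHit μ N (shift e) (y - z) := measurable_of_countable _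
    simp_rw [hin]
    rw [lintegral_prod]
    swap
    · refine Measurable.aemeasurable ?_
      refine measurable_from_prod_countable_right fun k => ?_
      show Measurable fun d : ℕ → ℤ => ∏ i ∈ Finset.range k, noHit μ N (shift e) (y - d i)
      exact Finset.measurable_prod _ fun i _ => hX.comp (measurable_pi_apply i)
    refine lintegral_congr fun k => ?_
    have := lintegral_prod_eq_prod_lintegral_of_indepFun (Finset.range k)
      (fun (i : ℕ) (d : ℕ → ℤ) => noHit μ N (shift e) (y - d i))
      (iIndepFun_infinitePi (P := fun _ : ℕ => μ)
        (X := fun _ z => noHit μ N (shift e) (y - z)) fun _ => hX)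
      (fun i => hX.comp (measurable_pi_apply i))
    rw [this]
    have h4 : ∀ i : ℕ, ∫⁻ d, noHit μ N (shift e) (y - d i) ∂(Measure.infinitePi fun _ : ℕ => μ) =
        ∫⁻ h, noHit μ N (shift e) (y - h) ∂μ := by
      intro i
      exact (measurePreserving_eval_infinitePi (fun _ : ℕ => μ) i).lintegral_comp hX
    simp [h4]

/-! ### The annealed law of the maximal displacement -/

theorem le_maxDisp_iff (ω : Marks) (x : ℤ) :
    ((x : ℝ) : EReal) ≤ maxDisp ω ↔ ∃ N, ω ∈ hit N x := by
  constructor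
  · intro h
    by_contra hcon
    have hlt : maxDisp ω ≤ (((x - 1 : ℤ) : ℝ) : EReal) := by
      refine iSup_le fun n => iSup₂_le fun u hu => ?_
      by_contra hu'
      refine hcon ⟨n, u, hu.1, hu.2.le, ?_⟩
      have := not_le.1 hu'
      rw [EReal.coe_lt_coe_iff] at this
      have : x - 1 < position ω u := by exact_mod_cast this
      omega
    have := h.trans hlt
    rw [EReal.coe_le_coe_iff] at this
    have : x ≤ x - 1 := by exact_mod_cast this
    omega
  · rintro ⟨N, u, hu, -, hp⟩
    refine le_trans ?_ (le_iSup_of_le (f := fun n => maxGen ω n) u.length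
      (le_iSup₂_of_le (f := fun (u : Node) _ => ((position ω u : ℝ) : EReal)) u ⟨hu, rfl⟩ le_rfl))
    exact_mod_cast hp

theorem futureLaw_eq_map (E : Measure OffspringLaw) [IsProbabilityMeasure E] :
    (envLaw E).map (fun ξ (k : ℕ) => ξ ((k : ℤ) + 1)) = futureLaw E :=
  Measure.map_infinitePi_infinitePi_of_inj (P := fun _ : ℤ => E) (f := fun k : ℕ => (k : ℤ) + 1)
    fun a b h => by simpa using h

theorem treeLaw_hit (μ : Measure ℤ) [IsProbabilityMeasure μ] (N : ℕ) (e : FutureEnv) (y : ℤ) :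
    treeLaw μ e (hit N y) = 1 - noHit μ N e y := by
  rw [← treeLaw_hit_compl, ← prob_compl_eq_one_sub (measurableSet_hit N y).compl, compl_compl]

theorem noHit_le_one (μ : Measure ℤ) [IsProbabilityMeasure μ] (N : ℕ) (e : FutureEnv) (y : ℤ) :
    noHit μ N e y ≤ 1 := by
  rw [← treeLaw_hit_compl]; exact prob_le_one

theorem measurable_noHit (μ : Measure ℤ) [IsProbabilityMeasure μ] (N : ℕ) (y : ℤ) :
    Measurable fun e => noHit μ N e y := by
  induction N generalizing y with
  | zero => simp only [noHit]; exact measurable_const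
  | succ N ih =>
    simp only [noHit]
    split_ifs
    · exact measurable_const
    have h1 : Measurable fun e => ∫⁻ h, noHit μ N (shift e) (y - h) ∂μ := by
      refine Measurable.lintegral_prod_right (f := fun e h => noHit μ N (shift e) (y - h)) ?_
      exact measurable_from_prod_countable_left fun h => (ih (y - h)).comp measurable_shift
    simp_rw [fun e : FutureEnv => lintegral_countable' (μ := (e 0 : Measure ℕ))
      fun k => (∫⁻ h, noHit μ N (shift e) (y - h) ∂μ) ^ k]
    refine Measurable.tsum fun k => ?_
    refine (h1.pow_const k).mul ?_
    exact ((Measure.measurable_coe (measurableSet_singleton k)).comp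
      measurable_subtype_coe).comp (measurable_pi_apply 0)

theorem annealed_le_maxDisp (E : Measure OffspringLaw) [IsProbabilityMeasure E]
    (μ : Measure ℤ) [IsProbabilityMeasure μ] (x : ℤ) :
    annealed E μ {p | ((x : ℝ) : EReal) ≤ maxDisp p.2} =
      ⨆ N, ∫⁻ e, (1 - noHit μ N e x) ∂futureLaw E := by
  have hset : {p : Env × Marks | ((x : ℝ) : EReal) ≤ maxDisp p.2} =
      ⋃ N, (Prod.snd ⁻¹' hit N x) := by
    ext p; simp [le_maxDisp_iff]
  have hm : ∀ N, MeasurableSet (Prod.snd ⁻¹' hit N x : Set (Env × Marks)) := fun N =>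
    (measurableSet_hit N x).preimage measurable_snd
  have hmono : Monotone fun N => (Prod.snd ⁻¹' hit N x : Set (Env × Marks)) :=
    fun N N' h => Set.preimage_mono (hit_mono h x)
  rw [hset, hmono.measure_iUnion]
  congr 1
  ext N
  have hf : Measurable fun e => 1 - noHit μ N e x :=
    measurable_const.sub (measurable_noHit μ N x)
  rw [annealed, Measure.compProd_apply (hm N), ← futureLaw_eq_map,
    lintegral_map hf (by fun_prop)]
  refine lintegral_congr fun ξ => ?_
  exact treeLaw_hit μ N (fun k => ξ ((k : ℤ) + 1)) x

end

section
/-! ### First passage of a walk without upward jumps larger than one -/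

/-- The exponential weight `e^{l y}` in `[0, ∞]`. -/
noncomputable def expWeight (l : ℝ) (y : ℤ) : ℝ≥0∞ := ENNReal.ofReal (Real.exp (l * y))

theorem expWeight_add (l : ℝ) (y z : ℤ) :
    expWeight l (y + z) = expWeight l y * expWeight l z := by
  rw [expWeight, expWeight, expWeight, ← ENNReal.ofReal_mul (Real.exp_nonneg _), ← Real.exp_add]
  push_cast; ring_nf

theorem expWeight_zero_right (l : ℝ) : expWeight l 0 = 1 := by simp [expWeight]

theorem expWeight_zero_left (y : ℤ) : expWeight 0 y = 1 := by simp [expWeight]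

theorem expWeight_ne_top (l : ℝ) (y : ℤ) : expWeight l y ≠ ∞ := ENNReal.ofReal_ne_top

theorem one_le_expWeight {l : ℝ} (hl : 0 ≤ l) {y : ℤ} (hy : 0 ≤ y) : 1 ≤ expWeight l y := by
  rw [expWeight, ENNReal.one_le_ofReal]
  exact Real.one_le_exp (mul_nonneg hl (by exact_mod_cast hy))

theorem expWeight_mul_neg (l : ℝ) (y : ℤ) : expWeight l y * expWeight l (-y) = 1 := by
  rw [← expWeight_add, add_neg_cancel, expWeight_zero_right]

theorem expWeight_sub (l : ℝ) (y h : ℤ) :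
    expWeight l (y - h) = expWeight l y * expWeight l (-h) := by
  rw [sub_eq_add_neg, expWeight_add]

/-- The probability that the walk with jump law `ν` reaches, for the first time at time `n`, the
level at distance `y` above its starting point. -/
noncomputable def firstPassage (ν : Measure ℤ) : ℕ → ℤ → ℝ≥0∞
  | 0, y => if y = 0 then 1 else 0
  | n + 1, y => if 0 < y then ∫⁻ h, firstPassage ν n (y - h) ∂ν else 0

/-- The probability that the walk with jump law `ν` needs more than `n` steps to reach the level at
distance `y` above its starting point. -/
noncomputable def notPassed (ν : Measure ℤ) : ℕ → ℤ → ℝ≥0∞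
  | 0, y => if 0 < y then 1 else 0
  | n + 1, y => if 0 < y then ∫⁻ h, notPassed ν n (y - h) ∂ν else 0

variable {ν : Measure ℤ}

theorem lintegral_expWeight_sub (l : ℝ) (y : ℤ) :
    ∫⁻ h, expWeight l (y - h) ∂ν = expWeight l y * ∫⁻ h, expWeight l (-h) ∂ν := by
  simp_rw [expWeight_sub]
  exact lintegral_const_mul _ (measurable_of_countable _)

theorem firstPassage_of_neg (n : ℕ) {y : ℤ} (hy : y < 0) : firstPassage ν n y = 0 := by
  cases n <;> simp [firstPassage, hy.ne, hy.not_gt]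

theorem firstPassage_zero_right (n : ℕ) : firstPassage ν (n + 1) 0 = 0 := by
  simp [firstPassage]

theorem notPassed_le {l : ℝ} (hl : 0 ≤ l) (n : ℕ) (y : ℤ) :
    notPassed ν n y ≤ expWeight l y * (∫⁻ h, expWeight l (-h) ∂ν) ^ n := by
  induction n generalizing y with
  | zero =>
    simp only [notPassed, pow_zero, mul_one]
    split_ifs with hy
    · exact one_le_expWeight hl hy.le
    · exact zero_le
  | succ n ih =>
    simp only [notPassed]
    split_ifs with hy
    · calc ∫⁻ h, notPassed ν n (y - h) ∂ν
          ≤ ∫⁻ h, expWeight l (y - h) * (∫⁻ h, expWeight l (-h) ∂ν) ^ n ∂ν :=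
            lintegral_mono fun h => ih _
        _ = _ := by
            rw [lintegral_mul_const _ (measurable_of_countable _), lintegral_expWeight_sub,
              pow_succ']
            ring
    · exact zero_le

theorem sum_firstPassage_add_notPassed [IsProbabilityMeasure ν] (hν : ∀ᵐ h ∂ν, h ≤ 1)
    (N : ℕ) {y : ℤ} (hy : 0 ≤ y) :
    ∑ n ∈ Finset.range (N + 1), firstPassage ν n y + notPassed ν N y = 1 := by
  induction N generalizing y with
  | zero =>
    rcases hy.eq_or_lt with rfl | hy
    · simp [firstPassage, notPassed]
    · simp [firstPassage, notPassed, hy, hy.ne']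
  | succ N ih =>
    rcases hy.eq_or_lt with rfl | hy
    · rw [Finset.sum_range_succ']
      simp [firstPassage, notPassed]
    · rw [Finset.sum_range_succ']
      simp only [firstPassage, hy, hy.ne', if_true, if_false, add_zero, notPassed]
      rw [← lintegral_finsetSum _ fun _ _ => measurable_of_countable _,
        ← lintegral_add_left (measurable_of_countable _)]
      calc _ = ∫⁻ _, 1 ∂ν := lintegral_congr_ae (hν.mono fun h hh => ih (by omega))
        _ = 1 := by simp

/-- A walk without upward jumps larger than one and with `E e^{-l h} < 1` reaches every level
above its starting point, and hits it exactly. -/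
theorem tsum_firstPassage [IsProbabilityMeasure ν] (hν : ∀ᵐ h ∂ν, h ≤ 1) {l : ℝ} (hl : 0 ≤ l)
    (hρ : ∫⁻ h, expWeight l (-h) ∂ν < 1) {y : ℤ} (hy : 0 ≤ y) :
    ∑' n, firstPassage ν n y = 1 := by
  have h0 : Tendsto (fun N => notPassed ν N y) atTop (𝓝 0) := by
    have h1 := ENNReal.Tendsto.const_mul (a := expWeight l y)
      (ENNReal.tendsto_pow_atTop_nhds_zero_of_lt_one hρ) (Or.inr (expWeight_ne_top l y))
    rw [mul_zero] at h1
    exact tendsto_of_tendsto_of_tendsto_of_le_of_le tendsto_const_nhds h1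
      (fun _ => zero_le) (fun N => notPassed_le hl N y)
  have h2 := ((ENNReal.tendsto_nat_tsum fun n => firstPassage ν n y).comp
    (tendsto_add_atTop_nat 1)).add h0
  rw [add_zero] at h2
  refine tendsto_nhds_unique h2 (tendsto_const_nhds.congr fun N => ?_)
  exact (sum_firstPassage_add_notPassed hν N hy).symm

theorem tsum_firstPassage_le_one [IsProbabilityMeasure ν] (hν : ∀ᵐ h ∂ν, h ≤ 1) {l : ℝ}
    (hl : 0 ≤ l) (hρ : ∫⁻ h, expWeight l (-h) ∂ν < 1) (y : ℤ) :
    ∑' n, firstPassage ν n y ≤ 1 := by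
  rcases le_or_gt 0 y with hy | hy
  · exact (tsum_firstPassage hν hl hρ hy).le
  · simp [firstPassage_of_neg _ hy]

theorem tsum_firstPassage_mul_expWeight_le (s : ℝ) (n : ℕ) :
    ∑' y, firstPassage ν n y * expWeight s (-y) ≤ (∫⁻ h, expWeight s (-h) ∂ν) ^ n := by
  induction n with
  | zero =>
    rw [tsum_eq_single 0 fun y hy => by simp [firstPassage, hy]]
    simp [firstPassage, expWeight_zero_right]
  | succ n ih =>
    calc ∑' y, firstPassage ν (n + 1) y * expWeight s (-y)
        ≤ ∑' y, ∫⁻ h, firstPassage ν n (y - h) * expWeight s (-y) ∂ν := by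
          refine ENNReal.tsum_le_tsum fun y => ?_
          rw [lintegral_mul_const _ (measurable_of_countable _)]
          refine mul_le_mul_left ?_ _
          simp only [firstPassage]
          split_ifs
          · exact le_rfl
          · exact zero_le
      _ = ∫⁻ h, ∑' y, firstPassage ν n (y - h) * expWeight s (-y) ∂ν :=
          (lintegral_tsum fun y => (measurable_of_countable _).aemeasurable).symm
      _ = ∫⁻ h, (∑' y, firstPassage ν n y * expWeight s (-y)) * expWeight s (-h) ∂ν := by
          refine lintegral_congr fun h => ?_
          rw [← (Equiv.subRight h).tsum_eq fun y => firstPassage ν n y * expWeight s (-y),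
            ← ENNReal.tsum_mul_right]
          refine tsum_congr fun y => ?_
          rw [Equiv.subRight_apply, mul_assoc, ← expWeight_add]
          ring_nf
      _ = (∑' y, firstPassage ν n y * expWeight s (-y)) * ∫⁻ h, expWeight s (-h) ∂ν :=
          lintegral_const_mul _ (measurable_of_countable _)
      _ ≤ _ := by rw [pow_succ]; exact mul_le_mul_left ih _

/-- The expected number of visits, at the times before `N`, to the site at distance `z` above the
starting point. -/
noncomputable def green (ν : Measure ℤ) : ℕ → ℤ → ℝ≥0∞
  | 0, _ => 0
  | N + 1, z => (if z = 0 then 1 else 0) + ∫⁻ h, green ν N (z - h) ∂ν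

theorem green_mono (N : ℕ) (z : ℤ) : green ν N z ≤ green ν (N + 1) z := by
  induction N generalizing z with
  | zero => exact zero_le
  | succ N ih => exact add_le_add le_rfl (lintegral_mono fun h => ih _)

/-- The maximum principle for the Green function. -/
theorem green_le_green_zero [IsProbabilityMeasure ν] (N : ℕ) (z : ℤ) :
    green ν N z ≤ green ν N 0 := by
  induction N generalizing z with
  | zero => exact le_rfl
  | succ N ih =>
    by_cases hz : z = 0
    · rw [hz]
    · calc green ν (N + 1) z = ∫⁻ h, green ν N (z - h) ∂ν := by simp [green, hz]
        _ ≤ ∫⁻ _, green ν N 0 ∂ν := lintegral_mono fun h => ih _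
        _ = green ν N 0 := by simp
        _ ≤ green ν (N + 1) 0 := green_mono N 0

theorem green_le [IsProbabilityMeasure ν] {l : ℝ}
    (hρ : ∫⁻ h, expWeight l (-h) ∂ν < 1) (N : ℕ) (z : ℤ) :
    green ν N z ≤ (1 - ∫⁻ h, expWeight l (-h) ∂ν)⁻¹ := by
  set ρ := ∫⁻ h, expWeight l (-h) ∂ν with hρdef
  have hfix : 1 + (1 - ρ)⁻¹ * ρ = (1 - ρ)⁻¹ := by
    have h1 : (1 - ρ)⁻¹ * (1 - ρ) = 1 :=
      ENNReal.inv_mul_cancel (tsub_pos_of_lt hρ).ne' (ENNReal.sub_ne_top ENNReal.one_ne_top)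
    nth_rw 1 [← h1]
    rw [← mul_add, tsub_add_cancel_of_le hρ.le, mul_one]
  have key : ∀ N z, green ν N z ≤ expWeight l z * (1 - ρ)⁻¹ := by
    intro N
    induction N with
    | zero => exact fun z => zero_le
    | succ N ih =>
      intro z
      calc green ν (N + 1) z
          ≤ expWeight l z + ∫⁻ h, expWeight l (z - h) * (1 - ρ)⁻¹ ∂ν := by
            refine add_le_add ?_ (lintegral_mono fun h => ih _)
            split_ifs with hz
            · rw [hz, expWeight_zero_right]
            · exact zero_le
        _ = expWeight l z * (1 + (1 - ρ)⁻¹ * ρ) := by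
            rw [lintegral_mul_const _ (measurable_of_countable _), lintegral_expWeight_sub]
            ring
        _ = _ := by rw [hfix]
  calc green ν N z ≤ green ν N 0 := green_le_green_zero N z
    _ ≤ expWeight l 0 * (1 - ρ)⁻¹ := key N 0
    _ = _ := by rw [expWeight_zero_right, one_mul]

/-- A potential with source `B` is at most the total mass of `B` times a bound on the Green
function. -/
theorem potential_le [IsProbabilityMeasure ν] {l : ℝ}
    (hρ : ∫⁻ h, expWeight l (-h) ∂ν < 1) {B : ℤ → ℝ≥0∞} {s : ℕ → ℤ → ℝ≥0∞}
    (h0 : ∀ y, s 0 y = 0) (hs : ∀ N y, s (N + 1) y ≤ B y + ∫⁻ h, s N (y - h) ∂ν)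
    (N : ℕ) (y : ℤ) :
    s N y ≤ (1 - ∫⁻ h, expWeight l (-h) ∂ν)⁻¹ * ∑' w, B w := by
  have key : ∀ N y, s N y ≤ ∑' w, green ν N (y - w) * B w := by
    intro N
    induction N with
    | zero => intro y; rw [h0]; exact zero_le
    | succ N ih =>
      intro y
      calc s (N + 1) y ≤ B y + ∫⁻ h, ∑' w, green ν N (y - h - w) * B w ∂ν :=
            (hs N y).trans (add_le_add le_rfl (lintegral_mono fun h => ih _))
        _ = (∑' w, (if y - w = 0 then 1 else 0) * B w) +
              ∑' w, (∫⁻ h, green ν N (y - w - h) ∂ν) * B w := by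
            congr 1
            · rw [tsum_eq_single y fun w hw => by simp [sub_eq_zero, hw.symm]]
              simp
            · rw [lintegral_tsum fun w => (measurable_of_countable _).aemeasurable]
              refine tsum_congr fun w => ?_
              rw [← lintegral_mul_const _ (measurable_of_countable _)]
              simp_rw [sub_right_comm]
        _ = _ := by
            rw [← ENNReal.tsum_add]
            refine tsum_congr fun w => ?_
            rw [← add_mul]; rfl
  refine (key N y).trans ?_
  rw [← ENNReal.tsum_mul_left]
  exact ENNReal.tsum_le_tsum fun w => mul_le_mul_left (green_le hρ N _) _

end

section
/-! ### Expected populations in a random environment -/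

/-- The product of the first `n` values of `m` along the environment. -/
noncomputable def envWeight (m : OffspringLaw → ℝ≥0∞) : ℕ → FutureEnv → ℝ≥0∞
  | 0, _ => 1
  | n + 1, e => m (e 0) * envWeight m n (shift e)

variable {m : OffspringLaw → ℝ≥0∞} {E : Measure OffspringLaw} [IsProbabilityMeasure E]

theorem measurable_envWeight (hm : Measurable m) (n : ℕ) : Measurable (envWeight m n) := by
  induction n with
  | zero => exact measurable_const
  | succ n ih =>
    exact (hm.comp (measurable_pi_apply 0)).mul (ih.comp measurable_shift)

theorem lintegral_envWeight (hm : Measurable m) (hE : ∫⁻ F, m F ∂E = 1) (n : ℕ) :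
    ∫⁻ e, envWeight m n e ∂futureLaw E = 1 := by
  induction n with
  | zero => simp [envWeight]
  | succ n ih =>
    simp only [envWeight]
    rw [lintegral_env_split E hm (measurable_envWeight hm n), hE, ih, one_mul]

theorem measurable_tsum_mul_envWeight (hm : Measurable m) (q : ℕ → ℝ≥0∞) :
    Measurable fun e => ∑' n, q n * envWeight m n e :=
  Measurable.tsum fun n => (measurable_envWeight hm n).const_mul _

theorem lintegral_tsum_mul_envWeight (hm : Measurable m) (hE : ∫⁻ F, m F ∂E = 1)
    (q : ℕ → ℝ≥0∞) : ∫⁻ e, ∑' n, q n * envWeight m n e ∂futureLaw E = ∑' n, q n := by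
  rw [lintegral_tsum fun n => ((measurable_envWeight hm n).const_mul _).aemeasurable]
  refine tsum_congr fun n => ?_
  rw [lintegral_const_mul _ (measurable_envWeight hm n), lintegral_envWeight hm hE, mul_one]

/-- A fractional moment of a mixture of the weights, when the first `j` environments are biased by
`m`.  Subadditivity of `x ↦ x ^ θ` reduces `j` to `j - 1`. -/
theorem lintegral_envWeight_mul_rpow_le (hm : Measurable m) (hE : ∫⁻ F, m F ∂E = 1)
    {θ : ℝ} (hθ0 : 0 < θ) (hθ1 : θ ≤ 1) (hφ : 1 ≤ ∫⁻ F, m F ^ (1 + θ) ∂E)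
    (j : ℕ) {q : ℕ → ℝ≥0∞} (hq : ∑' n, q n ≤ 1) :
    ∫⁻ e, envWeight m j e * (∑' n, q n * envWeight m n e) ^ θ ∂futureLaw E ≤
      ((j : ℝ≥0∞) + 2) * (∫⁻ F, m F ^ (1 + θ) ∂E) ^ j := by
  set φ := ∫⁻ F, m F ^ (1 + θ) ∂E with hφdef
  induction j generalizing q with
  | zero =>
    calc _ ≤ ∫⁻ e, (1 + ∑' n, q n * envWeight m n e) ∂futureLaw E := by
          refine lintegral_mono fun e => ?_
          simp only [envWeight, one_mul]
          set x := ∑' n, q n * envWeight m n e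
          rcases le_total x 1 with hx | hx
          · exact (ENNReal.rpow_le_one hx hθ0.le).trans le_self_add
          · calc x ^ θ ≤ x ^ (1 : ℝ) := ENNReal.rpow_le_rpow_of_exponent_le hx hθ1
              _ = x := ENNReal.rpow_one x
              _ ≤ 1 + x := le_add_self
      _ = 1 + ∑' n, q n := by
          rw [lintegral_add_left measurable_const, lintegral_tsum_mul_envWeight hm hE]
          simp
      _ ≤ 1 + 1 := by gcongr
      _ = _ := by norm_num
  | succ j ih =>
    have hq' : ∑' n, q (n + 1) ≤ 1 := by
      refine le_trans ?_ hq
      rw [tsum_eq_zero_add' (f := q) ENNReal.summable]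
      exact le_add_self
    set S : FutureEnv → ℝ≥0∞ := fun e => ∑' n, q (n + 1) * envWeight m n e with hS
    have hSm : Measurable S := measurable_tsum_mul_envWeight hm _
    have hrec : ∀ e, ∑' n, q n * envWeight m n e = q 0 + m (e 0) * S (shift e) := by
      intro e
      rw [tsum_eq_zero_add' ENNReal.summable, hS, ← ENNReal.tsum_mul_left]
      simp only [envWeight, mul_one]
      congr 1
      exact tsum_congr fun n => by ring
    have hq0 : q 0 ≤ 1 := (ENNReal.le_tsum 0).trans hq
    calc _ ≤ ∫⁻ e, (m (e 0) * envWeight m j (shift e) +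
          m (e 0) ^ (1 + θ) * (envWeight m j (shift e) * S (shift e) ^ θ)) ∂futureLaw E := by
          refine lintegral_mono fun e => ?_
          show envWeight m (j + 1) e * _ ≤ _
          rw [hrec]
          calc envWeight m (j + 1) e * (q 0 + m (e 0) * S (shift e)) ^ θ
              ≤ envWeight m (j + 1) e * (1 + m (e 0) ^ θ * S (shift e) ^ θ) := by
                gcongr
                refine (ENNReal.rpow_add_le_add_rpow _ _ hθ0.le hθ1).trans ?_
                rw [ENNReal.mul_rpow_of_nonneg _ _ hθ0.le]
                gcongr
                exact ENNReal.rpow_le_one hq0 hθ0.le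
            _ = _ := by
                rw [ENNReal.rpow_add_of_nonneg _ _ zero_le_one hθ0.le, ENNReal.rpow_one]
                simp only [envWeight]
                ring
      _ = 1 + φ * ∫⁻ e, envWeight m j e * S e ^ θ ∂futureLaw E := by
          have hPj := measurable_envWeight hm j
          rw [lintegral_add_left]
          · rw [lintegral_env_split E hm hPj, hE, lintegral_envWeight hm hE,
              lintegral_env_split E (g := fun F => m F ^ (1 + θ))
                (H := fun e => envWeight m j e * S e ^ θ) (hm.pow_const _)
                (hPj.mul (hSm.pow_const _)), one_mul]
          · exact (hm.comp (measurable_pi_apply 0)).mul (hPj.comp measurable_shift)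
      _ ≤ φ ^ (j + 1) + φ * (((j : ℝ≥0∞) + 2) * φ ^ j) := by
          gcongr
          · exact one_le_pow₀ hφ
          · exact ih hq'
      _ = _ := by push_cast; ring

/-- The expected number of particles that reach, at their first passage, the level at distance `y`,
normalized by the bias; the jump law is `ν` and the mean offspring numbers are `m`. -/
noncomputable def expectedHits (ν : Measure ℤ) (m : OffspringLaw → ℝ≥0∞) (e : FutureEnv) (y : ℤ) :
    ℝ≥0∞ :=
  ∑' n, firstPassage ν n y * envWeight m n e

variable {ν : Measure ℤ}

theorem measurable_expectedHits (hm : Measurable m) (y : ℤ) :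
    Measurable fun e => expectedHits ν m e y :=
  measurable_tsum_mul_envWeight hm _

theorem expectedHits_zero (e : FutureEnv) : expectedHits ν m e 0 = 1 := by
  rw [expectedHits, tsum_eq_single 0]
  · simp [firstPassage, envWeight]
  · intro n hn
    obtain ⟨n, rfl⟩ := Nat.exists_eq_succ_of_ne_zero hn
    simp [firstPassage_zero_right]

theorem expectedHits_of_pos (e : FutureEnv) {y : ℤ} (hy : 0 < y) :
    expectedHits ν m e y = m (e 0) * ∫⁻ h, expectedHits ν m (shift e) (y - h) ∂ν := by
  simp only [expectedHits]
  rw [tsum_eq_zero_add' ENNReal.summable,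
    lintegral_tsum fun n => (measurable_of_countable _).aemeasurable, ← ENNReal.tsum_mul_left]
  simp only [firstPassage, hy.ne', hy, if_true, if_false, zero_mul, zero_add, envWeight]
  refine tsum_congr fun n => ?_
  rw [lintegral_mul_const _ (measurable_of_countable _)]
  ring

/-- The part of the expected number of first passages after `n` steps that comes from lines of
descent along which the `j`-th vertex before the end is never in the exceptional set `bad j`. -/
noncomputable def goodHits (ν : Measure ℤ) (m : OffspringLaw → ℝ≥0∞)
    (bad : ℕ → ℤ → Set FutureEnv) : ℕ → FutureEnv → ℤ → ℝ≥0∞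
  | 0, _, y => if y = 0 then 1 else 0
  | n + 1, e, y => if 0 < y then
      (bad (n + 1) y)ᶜ.indicator
        (fun e => m (e 0) * ∫⁻ h, goodHits ν m bad n (shift e) (y - h) ∂ν) e else 0

variable {bad : ℕ → ℤ → Set FutureEnv}

theorem measurable_lintegral_int {f : FutureEnv → ℤ → ℝ≥0∞} (hf : ∀ y, Measurable fun e => f e y)
    (y : ℤ) : Measurable fun e => ∫⁻ h, f e (y - h) ∂ν := by
  simp_rw [lintegral_countable']
  exact Measurable.tsum fun h => (hf _).mul_const _

theorem measurable_goodHits (hm : Measurable m) (hbad : ∀ j y, MeasurableSet (bad j y))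
    (n : ℕ) (y : ℤ) : Measurable fun e => goodHits ν m bad n e y := by
  induction n generalizing y with
  | zero => exact measurable_const
  | succ n ih =>
    simp only [goodHits]
    split_ifs
    · exact ((hm.comp (measurable_pi_apply 0)).mul
        ((measurable_lintegral_int ih y).comp measurable_shift)).indicator (hbad _ _).compl
    · exact measurable_const

theorem goodHits_le (n : ℕ) (e : FutureEnv) (y : ℤ) :
    goodHits ν m bad n e y ≤ firstPassage ν n y * envWeight m n e := by
  induction n generalizing e y with
  | zero => simp [goodHits, firstPassage, envWeight]
  | succ n ih =>
    simp only [goodHits, firstPassage, envWeight]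
    split_ifs
    · refine (Set.indicator_le_self _ _ _).trans ?_
      calc m (e 0) * ∫⁻ h, goodHits ν m bad n (shift e) (y - h) ∂ν
          ≤ m (e 0) * ∫⁻ h, firstPassage ν n (y - h) * envWeight m n (shift e) ∂ν := by
            gcongr; exact ih _ _
        _ = _ := by rw [lintegral_mul_const _ (measurable_of_countable _)]; ring
    · exact zero_le

/-- The expected weight of the lines of descent of length `j` and height `y` that start in the
exceptional set. -/
noncomputable def badMass (E : Measure OffspringLaw) [IsProbabilityMeasure E] (ν : Measure ℤ)
    (m : OffspringLaw → ℝ≥0∞) (bad : ℕ → ℤ → Set FutureEnv) (j : ℕ) (y : ℤ) : ℝ≥0∞ :=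
  firstPassage ν j y * ∫⁻ e in bad j y, envWeight m j e ∂futureLaw E

/-- A bound on the expected weight of the lines of descent of length `n` and height `y` with an
exceptional vertex, if `β j w` is the weight of those of length `j` and height `w` that start in
one. -/
noncomputable def lostMass (ν : Measure ℤ) (β : ℕ → ℤ → ℝ≥0∞) : ℕ → ℤ → ℝ≥0∞
  | 0, _ => 0
  | n + 1, y => if 0 < y then β (n + 1) y + ∫⁻ h, lostMass ν β n (y - h) ∂ν else 0

theorem firstPassage_le_goodHits_add_lostMass (hm : Measurable m) (hE : ∫⁻ F, m F ∂E = 1)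
    (hbad : ∀ j y, MeasurableSet (bad j y)) (n : ℕ) (y : ℤ) :
    firstPassage ν n y ≤ ∫⁻ e, goodHits ν m bad n e y ∂futureLaw E +
      lostMass ν (badMass E ν m bad) n y := by
  induction n generalizing y with
  | zero => simp [firstPassage, goodHits, lostMass]
  | succ n ih =>
    by_cases hy : 0 < y
    swap
    · simp [firstPassage, hy]
    have hg := measurable_goodHits (ν := ν) hm hbad n
    have hI := measurable_lintegral_int (ν := ν) hg y
    have hf : Measurable fun e : FutureEnv =>
        m (e 0) * ∫⁻ h, goodHits ν m bad n (shift e) (y - h) ∂ν :=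
      (hm.comp (measurable_pi_apply 0)).mul (hI.comp measurable_shift)
    have hswap : ∫⁻ h, ∫⁻ e, goodHits ν m bad n e (y - h) ∂futureLaw E ∂ν =
        ∫⁻ e, m (e 0) * ∫⁻ h, goodHits ν m bad n (shift e) (y - h) ∂ν ∂futureLaw E := by
      rw [lintegral_env_split E hm hI, hE, one_mul]
      simp_rw [lintegral_countable']
      rw [lintegral_tsum fun h => ((hg _).mul_const _).aemeasurable]
      exact tsum_congr fun h => (lintegral_mul_const _ (hg _)).symm
    have hbadle : ∫⁻ e in bad (n + 1) y,
        m (e 0) * ∫⁻ h, goodHits ν m bad n (shift e) (y - h) ∂ν ∂futureLaw E ≤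
        badMass E ν m bad (n + 1) y := by
      rw [badMass, ← lintegral_const_mul _ (measurable_envWeight hm _)]
      refine lintegral_mono fun e => ?_
      calc m (e 0) * ∫⁻ h, goodHits ν m bad n (shift e) (y - h) ∂ν
          ≤ m (e 0) * ∫⁻ h, firstPassage ν n (y - h) * envWeight m n (shift e) ∂ν := by
            gcongr; exact goodHits_le _ _ _
        _ = _ := by
            rw [lintegral_mul_const _ (measurable_of_countable _)]
            simp only [firstPassage, hy, if_true, envWeight]
            ring
    calc firstPassage ν (n + 1) y = ∫⁻ h, firstPassage ν n (y - h) ∂ν := by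
          simp [firstPassage, hy]
      _ ≤ ∫⁻ h, (∫⁻ e, goodHits ν m bad n e (y - h) ∂futureLaw E +
            lostMass ν (badMass E ν m bad) n (y - h)) ∂ν := lintegral_mono fun h => ih _
      _ = (∫⁻ e in (bad (n + 1) y)ᶜ,
              m (e 0) * ∫⁻ h, goodHits ν m bad n (shift e) (y - h) ∂ν ∂futureLaw E +
            ∫⁻ e in bad (n + 1) y,
              m (e 0) * ∫⁻ h, goodHits ν m bad n (shift e) (y - h) ∂ν ∂futureLaw E) +
            ∫⁻ h, lostMass ν (badMass E ν m bad) n (y - h) ∂ν := by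
          rw [lintegral_add_left (measurable_of_countable _), hswap,
            add_comm (∫⁻ e in (bad (n + 1) y)ᶜ, _ ∂futureLaw E),
            lintegral_add_compl _ (hbad _ _)]
      _ ≤ _ := by
          simp only [goodHits, hy, if_true, lostMass]
          rw [lintegral_indicator (hbad _ _).compl, add_assoc]
          gcongr

theorem sum_lostMass_le [IsProbabilityMeasure ν] {l : ℝ}
    (hρ : ∫⁻ h, expWeight l (-h) ∂ν < 1) (β : ℕ → ℤ → ℝ≥0∞) (N : ℕ) (y : ℤ) :
    ∑ n ∈ Finset.range (N + 1), lostMass ν β n y ≤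
      (1 - ∫⁻ h, expWeight l (-h) ∂ν)⁻¹ * ∑' w, ∑' j, β (j + 1) w := by
  refine potential_le hρ (B := fun w => ∑' j, β (j + 1) w)
    (s := fun N y => ∑ n ∈ Finset.range (N + 1), lostMass ν β n y) ?_ ?_ N y
  · intro y; simp [lostMass]
  · intro N y
    rw [Finset.sum_range_succ', lintegral_finsetSum _ fun _ _ => measurable_of_countable _]
    simp only [lostMass, add_zero]
    split_ifs with hy
    · rw [Finset.sum_add_distrib]
      gcongr
      exact ENNReal.sum_le_tsum _
    · simp

/-- The good lines of descent carry at least half of the mass once the exceptional sets have a small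
total weight. -/
theorem half_le_tsum_goodHits [IsProbabilityMeasure ν] (hν : ∀ᵐ h ∂ν, h ≤ 1) {l : ℝ} (hl : 0 ≤ l)
    (hρ : ∫⁻ h, expWeight l (-h) ∂ν < 1) (hm : Measurable m) (hE : ∫⁻ F, m F ∂E = 1)
    (hbad : ∀ j y, MeasurableSet (bad j y))
    (hsmall : (1 - ∫⁻ h, expWeight l (-h) ∂ν)⁻¹ *
      ∑' w, ∑' j, badMass E ν m bad (j + 1) w ≤ 1 / 2) {y : ℤ} (hy : 0 ≤ y) :
    1 / 2 ≤ ∑' n, ∫⁻ e, goodHits ν m bad n e y ∂futureLaw E := by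
  have h1 : (1 : ℝ≥0∞) ≤ ∑' n, ∫⁻ e, goodHits ν m bad n e y ∂futureLaw E + 1 / 2 := by
    refine (tsum_firstPassage hν hl hρ hy).symm.le.trans ?_
    rw [ENNReal.tsum_eq_iSup_nat' (tendsto_add_atTop_nat 1)]
    refine iSup_le fun N => ?_
    calc ∑ n ∈ Finset.range (N + 1), firstPassage ν n y
        ≤ ∑ n ∈ Finset.range (N + 1), (∫⁻ e, goodHits ν m bad n e y ∂futureLaw E +
            lostMass ν (badMass E ν m bad) n y) :=
          Finset.sum_le_sum fun n _ => firstPassage_le_goodHits_add_lostMass hm hE hbad n y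
      _ ≤ _ := by
          rw [Finset.sum_add_distrib]
          exact add_le_add (ENNReal.sum_le_tsum _) ((sum_lostMass_le hρ _ N y).trans hsmall)
  have h2 : (1 / 2 : ℝ≥0∞) = 1 - 1 / 2 := by
    rw [one_div, ENNReal.one_sub_inv_two]
  rw [h2]
  exact tsub_le_iff_right.2 h1

end

section
/-! ### The exceptional sets are negligible -/

/-- `e^x` in `[0, ∞]`. -/
noncomputable def eexp (x : ℝ) : ℝ≥0∞ := ENNReal.ofReal (Real.exp x)

theorem eexp_add (x y : ℝ) : eexp (x + y) = eexp x * eexp y := by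
  rw [eexp, eexp, eexp, ← ENNReal.ofReal_mul (Real.exp_nonneg _), Real.exp_add]

theorem eexp_zero : eexp 0 = 1 := by simp [eexp]

theorem eexp_pos (x : ℝ) : 0 < eexp x := ENNReal.ofReal_pos.2 (Real.exp_pos x)

theorem eexp_ne_top (x : ℝ) : eexp x ≠ ∞ := ENNReal.ofReal_ne_top

theorem eexp_rpow (x θ : ℝ) : eexp x ^ θ = eexp (θ * x) := by
  rw [eexp, eexp, ENNReal.ofReal_rpow_of_pos (Real.exp_pos x), ← Real.exp_mul, mul_comm]

theorem eexp_pow (x : ℝ) (n : ℕ) : eexp x ^ n = eexp (n * x) := by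
  rw [← ENNReal.rpow_natCast, eexp_rpow]

theorem eexp_mono {x y : ℝ} (h : x ≤ y) : eexp x ≤ eexp y :=
  ENNReal.ofReal_le_ofReal (Real.exp_le_exp.2 h)

theorem eexp_neg (x : ℝ) : eexp (-x) = (eexp x)⁻¹ := by
  refine ENNReal.eq_inv_of_mul_eq_one_left ?_
  rw [← eexp_add, neg_add_cancel, eexp_zero]

theorem expWeight_rpow (l θ : ℝ) (y : ℤ) : expWeight l y ^ θ = expWeight (θ * l) y := by
  have := eexp_rpow (l * y) θ
  rw [← mul_assoc] at this
  exact this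

theorem ofReal_le_logPlus {x : ℝ} {η : ℝ≥0∞} (h : eexp x < η) :
    ENNReal.ofReal x ≤ logPlus η := by
  have h1 : (x : EReal) ≤ ENNReal.log (max η 1) := by
    rw [show (x : EReal) = ENNReal.log (eexp x) by
      rw [eexp, ENNReal.log_ofReal_of_pos (Real.exp_pos x), Real.log_exp]]
    exact ENNReal.log_monotone (h.le.trans (le_max_left _ _))
  have h2 := EReal.toENNReal_le_toENNReal h1
  rwa [EReal.toENNReal_of_ne_top (EReal.coe_ne_top x), EReal.toReal_coe] at h2

/-- The number of levels `e^{c i}`, `i ≥ 1`, below `η` is at most `log₊ η / c`. -/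
theorem tsum_indicator_eexp_le {c : ℝ} (hc : 0 < c) (η : ℝ≥0∞) :
    ∑' i : ℕ, (if eexp (c * (i + 1)) < η then 1 else 0) ≤ logPlus η / ENNReal.ofReal c := by
  rw [ENNReal.le_div_iff_mul_le (Or.inl (ENNReal.ofReal_pos.2 hc).ne')
    (Or.inl ENNReal.ofReal_ne_top), ← ENNReal.tsum_mul_right, ENNReal.tsum_eq_iSup_nat]
  refine iSup_le fun N => ?_
  induction N with
  | zero => simp
  | succ N ih =>
    by_cases h : eexp (c * (N + 1)) < η
    · calc _ ≤ ∑ _i ∈ Finset.range (N + 1), ENNReal.ofReal c := by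
            refine Finset.sum_le_sum fun i _ => ?_
            split_ifs <;> simp
        _ = ENNReal.ofReal (c * (N + 1)) := by
            rw [Finset.sum_const, Finset.card_range, mul_comm, ENNReal.ofReal_mul (by positivity),
              nsmul_eq_mul]
            congr 1
            rw [← Nat.cast_succ, ENNReal.ofReal_natCast]
        _ ≤ _ := ofReal_le_logPlus h
    · rw [Finset.sum_range_succ, if_neg h, zero_mul, add_zero]
      exact ih

variable {m η : OffspringLaw → ℝ≥0∞} {E : Measure OffspringLaw} {ν : Measure ℤ}

theorem tsum_lintegral_tail_ne_top (hm : Measurable m) (hη : Measurable η)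
    (hlog : ∫⁻ F, m F * logPlus (η F) ∂E < ∞) {c : ℝ} (hc : 0 < c) :
    ∑' i : ℕ, ∫⁻ F in {F | eexp (c * (i + 1)) < η F}, m F ∂E ≠ ∞ := by
  have hms : ∀ i : ℕ, MeasurableSet {F | eexp (c * (i + 1)) < η F} := fun i =>
    measurableSet_lt measurable_const hη
  simp_rw [← fun i => lintegral_indicator (μ := E) (hms i) m]
  rw [← lintegral_tsum fun i => (hm.indicator (hms i)).aemeasurable]
  refine ne_top_of_le_ne_top (b := (∫⁻ F, m F * logPlus (η F) ∂E) / ENNReal.ofReal c)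
    (ENNReal.div_ne_top hlog.ne (ENNReal.ofReal_pos.2 hc).ne') ?_
  have hc' : (ENNReal.ofReal c)⁻¹ ≠ ∞ := ENNReal.inv_ne_top.2 (ENNReal.ofReal_pos.2 hc).ne'
  rw [div_eq_mul_inv, ← lintegral_mul_const' _ _ hc']
  refine lintegral_mono fun F => ?_
  dsimp only
  rw [mul_assoc, ← div_eq_mul_inv]
  refine le_trans (le_of_eq ?_) (mul_le_mul_right (tsum_indicator_eexp_le hc (η F)) (m F))
  rw [← ENNReal.tsum_mul_left]
  refine tsum_congr fun i => ?_
  simp [Set.indicator_apply]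

variable [IsProbabilityMeasure E]

/-- The environments in which the expected number of hits is too large, relative to the threshold
`b j`, to be controlled by the second moment `η` of the first offspring law. -/
def badSet (ν : Measure ℤ) (m η : OffspringLaw → ℝ≥0∞) (l : ℝ) (b : ℕ → ℝ≥0∞) (j : ℕ) (y : ℤ) :
    Set FutureEnv :=
  {e | b j < η (e 0) * (expWeight l (-y) * expectedHits ν m e y)}

theorem measurableSet_badSet (hm : Measurable m) (hη : Measurable η) (l : ℝ) (b : ℕ → ℝ≥0∞)
    (j : ℕ) (y : ℤ) : MeasurableSet (badSet ν m η l b j y) :=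
  measurableSet_lt measurable_const
    ((hη.comp (measurable_pi_apply 0)).mul ((measurable_expectedHits hm y).const_mul _))

/-- The thresholds `e^{c (2 M - j)}`.  They are products of a level `e^{c (M + j)}` for the second
moment `η` and a level `e^{c (M - 2 j)}` for the expected number of hits; a large `M` makes both
unlikely to be exceeded, while the thresholds remain summable in `j`. -/
noncomputable def threshold (c : ℝ) (M j : ℕ) : ℝ≥0∞ := eexp (c * (2 * M - j))

theorem badMass_le [IsProbabilityMeasure ν] (hν : ∀ᵐ h ∂ν, h ≤ 1) {l : ℝ} (hl : 0 ≤ l)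
    (hρ : ∫⁻ h, expWeight l (-h) ∂ν < 1) (hm : Measurable m) (hE : ∫⁻ F, m F ∂E = 1)
    (hη : Measurable η) {θ : ℝ} (hθ0 : 0 < θ) (hθ1 : θ ≤ 1)
    (hφ : 1 ≤ ∫⁻ F, m F ^ (1 + θ) ∂E) (c : ℝ) (M j : ℕ) (y : ℤ) :
    badMass E ν m (badSet ν m η l (threshold c M)) (j + 1) y ≤
      firstPassage ν (j + 1) y *
        (∫⁻ F in {F | eexp (c * ((j + M : ℕ) + 1)) < η F}, m F ∂E) +
      eexp (-(θ * c * M)) * (firstPassage ν (j + 1) y * expWeight (θ * l) (-y) *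
        (((j + 1 : ℕ) + 2 : ℝ≥0∞) *
          (eexp (2 * θ * c) * ∫⁻ F, m F ^ (1 + θ) ∂E) ^ (j + 1))) := by
  set φ := ∫⁻ F, m F ^ (1 + θ) ∂E with hφdef
  set A : Set FutureEnv := {e | eexp (c * ((j + M : ℕ) + 1)) < η (e 0)} with hA
  have hAm : MeasurableSet A :=
    measurableSet_lt measurable_const (hη.comp (measurable_pi_apply 0))
  have hP := measurable_envWeight hm (j + 1)
  have hV := measurable_expectedHits (ν := ν) hm y
  set t : ℝ := c * (M - 2 * (j + 1)) with ht
  have h1 : ∫⁻ e in A, envWeight m (j + 1) e ∂futureLaw E =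
      ∫⁻ F in {F | eexp (c * ((j + M : ℕ) + 1)) < η F}, m F ∂E := by
    have hms : MeasurableSet {F | eexp (c * ((j + M : ℕ) + 1)) < η F} :=
      measurableSet_lt measurable_const hη
    rw [← lintegral_indicator hAm, ← lintegral_indicator hms]
    have := lintegral_env_split E (hm.indicator hms) (measurable_envWeight hm j)
    rw [lintegral_envWeight hm hE, mul_one] at this
    rw [← this]
    refine lintegral_congr fun e => ?_
    simp [Set.indicator_apply, hA, envWeight]
  have hsub : badSet ν m η l (threshold c M) (j + 1) y ⊆
      A ∪ {e | eexp t < expWeight l (-y) * expectedHits ν m e y} := by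
    intro e he
    by_contra hcon
    simp only [Set.mem_union, not_or, hA, Set.mem_ofPred_eq, not_lt] at hcon
    refine absurd (show threshold c M (j + 1) < _ from he) (not_lt.2 ?_)
    calc _ ≤ eexp (c * ((j + M : ℕ) + 1)) * eexp t := mul_le_mul' hcon.1 hcon.2
      _ = threshold c M (j + 1) := by
        rw [threshold, ← eexp_add]; congr 1; rw [ht]; push_cast; ring
  have h2 : ∫⁻ e in {e | eexp t < expWeight l (-y) * expectedHits ν m e y},
      envWeight m (j + 1) e ∂futureLaw E ≤
      eexp (-(θ * t)) * (expWeight (θ * l) (-y) * (((j + 1 : ℕ) + 2 : ℝ≥0∞) * φ ^ (j + 1))) := by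
    calc _ ≤ ∫⁻ e in {e | eexp t < expWeight l (-y) * expectedHits ν m e y},
            eexp (-(θ * t)) * (expWeight (θ * l) (-y) *
              (envWeight m (j + 1) e * expectedHits ν m e y ^ θ)) ∂futureLaw E := by
          refine setLIntegral_mono' (measurableSet_lt measurable_const (hV.const_mul _))
            fun e he => ?_
          have h3 : (1 : ℝ≥0∞) ≤ eexp (-(θ * t)) *
              (expWeight (θ * l) (-y) * expectedHits ν m e y ^ θ) := by
            calc (1 : ℝ≥0∞) = eexp (-(θ * t)) * eexp t ^ θ := by
                  rw [eexp_rpow, ← eexp_add, neg_add_cancel, eexp_zero]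
              _ ≤ eexp (-(θ * t)) * (expWeight l (-y) * expectedHits ν m e y) ^ θ := by
                  gcongr; exact le_of_lt he
              _ = _ := by rw [ENNReal.mul_rpow_of_nonneg _ _ hθ0.le, expWeight_rpow]
          calc envWeight m (j + 1) e = 1 * envWeight m (j + 1) e := (one_mul _).symm
            _ ≤ _ := mul_le_mul_left h3 _
            _ = _ := by ring
      _ ≤ ∫⁻ e, eexp (-(θ * t)) * (expWeight (θ * l) (-y) *
              (envWeight m (j + 1) e * expectedHits ν m e y ^ θ)) ∂futureLaw E :=
          setLIntegral_le_lintegral _ _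
      _ ≤ _ := by
          have h4 : Measurable fun e => envWeight m (j + 1) e * expectedHits ν m e y ^ θ :=
            hP.mul (hV.pow_const _)
          rw [lintegral_const_mul _ (h4.const_mul _), lintegral_const_mul _ h4]
          gcongr
          exact lintegral_envWeight_mul_rpow_le hm hE hθ0 hθ1 hφ (j + 1)
            (tsum_firstPassage_le_one hν hl hρ y)
  calc badMass E ν m (badSet ν m η l (threshold c M)) (j + 1) y
      ≤ firstPassage ν (j + 1) y * (∫⁻ e in A, envWeight m (j + 1) e ∂futureLaw E +
          ∫⁻ e in {e | eexp t < expWeight l (-y) * expectedHits ν m e y},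
            envWeight m (j + 1) e ∂futureLaw E) := by
        rw [badMass]
        gcongr
        exact (lintegral_mono_set hsub).trans (lintegral_union_le _ _ _)
    _ ≤ firstPassage ν (j + 1) y * (∫⁻ F in {F | eexp (c * ((j + M : ℕ) + 1)) < η F}, m F ∂E +
          eexp (-(θ * t)) *
            (expWeight (θ * l) (-y) * (((j + 1 : ℕ) + 2 : ℝ≥0∞) * φ ^ (j + 1)))) := by
        gcongr
        exact h1.le
    _ = _ := by
        have h5 : eexp (-(θ * t)) = eexp (-(θ * c * M)) * eexp (2 * θ * c) ^ (j + 1) := by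
          rw [eexp_pow, ← eexp_add]; congr 1; rw [ht]; push_cast; ring
        rw [h5, mul_pow]
        ring

theorem tsum_linear_mul_pow_ne_top {r : ℝ≥0∞} (hr : r < 1) :
    ∑' j : ℕ, (((j + 1 : ℕ) + 2 : ℝ≥0∞) * r ^ (j + 1)) ≠ ∞ := by
  lift r to NNReal using hr.ne_top
  have hr' : (r : ℝ) < 1 := by exact_mod_cast hr
  have h1 : Summable fun n : ℕ => ((n : ℝ) + 2) * (r : ℝ) ^ n := by
    have h2 := summable_pow_mul_geometric_of_norm_lt_one 1
      (show ‖(r : ℝ)‖ < 1 by simpa using hr')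
    have h3 := (summable_geometric_of_lt_one r.2 hr').mul_left 2
    refine (h2.add h3).congr fun n => ?_
    simp only [NNReal.val_eq_coe]
    ring
  have h4 : Summable fun n : ℕ => ((n + 1 : ℕ) + 2 : NNReal) * r ^ (n + 1) := by
    rw [← NNReal.summable_coe]
    exact_mod_cast (summable_nat_add_iff 1).2 h1
  exact_mod_cast ENNReal.tsum_coe_ne_top_iff_summable.2 h4

/-- For suitable thresholds the lines of descent through exceptional sets have a small total
weight. -/
theorem exists_threshold [IsProbabilityMeasure ν] (hν : ∀ᵐ h ∂ν, h ≤ 1) {l : ℝ} (hl : 0 ≤ l)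
    (hρ : ∫⁻ h, expWeight l (-h) ∂ν < 1) (hm : Measurable m) (hE : ∫⁻ F, m F ∂E = 1)
    (hη : Measurable η) (hlog : ∫⁻ F, m F * logPlus (η F) ∂E < ∞)
    {θ : ℝ} (hθ0 : 0 < θ) (hθ1 : θ ≤ 1) (hφ : 1 ≤ ∫⁻ F, m F ^ (1 + θ) ∂E)
    (hφψ : (∫⁻ F, m F ^ (1 + θ) ∂E) * ∫⁻ h, expWeight (θ * l) (-h) ∂ν < 1)
    {ε : ℝ≥0∞} (hε : 0 < ε) :
    ∃ c : ℝ, 0 < c ∧ ∃ M : ℕ,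
      ∑' w, ∑' j, badMass E ν m (badSet ν m η l (threshold c M)) (j + 1) w ≤ ε := by
  set φ := ∫⁻ F, m F ^ (1 + θ) ∂E with hφdef
  set ψ := ∫⁻ h, expWeight (θ * l) (-h) ∂ν with hψdef
  obtain ⟨c, hc, hr⟩ : ∃ c : ℝ, 0 < c ∧ eexp (2 * θ * c) * (φ * ψ) < 1 := by
    have hcont : Tendsto (fun c : ℝ => eexp (2 * θ * c) * (φ * ψ)) (𝓝[>] 0) (𝓝 (1 * (φ * ψ))) := by
      refine ENNReal.Tendsto.mul_const ?_ (Or.inl one_ne_zero)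
      have : Continuous fun c : ℝ => eexp (2 * θ * c) := by
        exact ENNReal.continuous_ofReal.comp (by fun_prop)
      have h := this.tendsto 0
      rw [mul_zero, eexp_zero] at h
      exact h.mono_left nhdsWithin_le_nhds
    rw [one_mul] at hcont
    obtain ⟨c, h1, h2⟩ := ((hcont.eventually_lt_const hφψ).and self_mem_nhdsWithin).exists
    exact ⟨c, h2, h1⟩
  refine ⟨c, hc, ?_⟩
  set T : ℕ → ℝ≥0∞ := fun i => ∫⁻ F in {F | eexp (c * (i + 1)) < η F}, m F ∂E with hT
  set r := eexp (2 * θ * c) * (φ * ψ) with hrdef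
  have hTsum : ∑' i, T i ≠ ∞ := tsum_lintegral_tail_ne_top hm hη hlog hc
  set D := ∑' j : ℕ, (((j + 1 : ℕ) + 2 : ℝ≥0∞) * r ^ (j + 1)) with hD
  have hDtop : D ≠ ∞ := tsum_linear_mul_pow_ne_top hr
  have hlim : Tendsto (fun M : ℕ => ∑' j, T (j + M) + eexp (-(θ * c * M)) * D) atTop (𝓝 0) := by
    have h1 := ENNReal.tendsto_sum_nat_add T hTsum
    have h2 : Tendsto (fun M : ℕ => eexp (-(θ * c * M)) * D) atTop (𝓝 (0 * D)) := by
      refine ENNReal.Tendsto.mul_const ?_ (Or.inr hDtop)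
      have h3 : eexp (-(θ * c)) < 1 := by
        rw [eexp, ENNReal.ofReal_lt_one, Real.exp_lt_one_iff]
        have := mul_pos hθ0 hc
        linarith
      refine (ENNReal.tendsto_pow_atTop_nhds_zero_of_lt_one h3).congr fun M => ?_
      rw [eexp_pow]; congr 1; ring
    have h4 := h1.add h2
    rwa [zero_mul, add_zero] at h4
  obtain ⟨M, hM⟩ := (hlim.eventually_lt_const hε).exists
  refine ⟨M, le_trans ?_ hM.le⟩
  rw [ENNReal.tsum_comm, hD, ← ENNReal.tsum_mul_left, ← ENNReal.tsum_add]
  refine ENNReal.tsum_le_tsum fun j => ?_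
  have hq0 : ∑' y, firstPassage ν (j + 1) y ≤ 1 := by
    have := tsum_firstPassage_mul_expWeight_le (ν := ν) 0 (j + 1)
    simpa [expWeight_zero_left] using this
  have hqψ := tsum_firstPassage_mul_expWeight_le (ν := ν) (θ * l) (j + 1)
  calc _ ≤ ∑' y, (firstPassage ν (j + 1) y * T (j + M) +
        eexp (-(θ * c * M)) * (firstPassage ν (j + 1) y * expWeight (θ * l) (-y) *
        (((j + 1 : ℕ) + 2 : ℝ≥0∞) * (eexp (2 * θ * c) * φ) ^ (j + 1)))) :=
        ENNReal.tsum_le_tsum fun y =>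
          badMass_le hν hl hρ hm hE hη hθ0 hθ1 hφ c M j y
    _ = (∑' y, firstPassage ν (j + 1) y) * T (j + M) +
        eexp (-(θ * c * M)) * ((∑' y, firstPassage ν (j + 1) y * expWeight (θ * l) (-y)) *
        (((j + 1 : ℕ) + 2 : ℝ≥0∞) * (eexp (2 * θ * c) * φ) ^ (j + 1))) := by
        rw [ENNReal.tsum_add, ENNReal.tsum_mul_right, ENNReal.tsum_mul_left,
          ENNReal.tsum_mul_right]
    _ ≤ 1 * T (j + M) + eexp (-(θ * c * M)) * (ψ ^ (j + 1) *
        (((j + 1 : ℕ) + 2 : ℝ≥0∞) * (eexp (2 * θ * c) * φ) ^ (j + 1))) := by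
        gcongr
    _ = _ := by
        rw [one_mul, hrdef]
        congr 2
        rw [← mul_assoc (eexp _) φ ψ, mul_pow _ ψ]
        ring

end

section
/-! ### One generation of branching -/

theorem measurable_offspringMean : Measurable offspringMean := by
  unfold offspringMean
  exact Measurable.tsum fun k => ((Measure.measurable_coe (measurableSet_singleton k)).comp
    measurable_subtype_coe).const_mul _

theorem measurable_factorialMoment : Measurable factorialMoment := by
  unfold factorialMoment
  refine Measurable.div ?_ (measurable_offspringMean.pow_const 2)
  exact Measurable.tsum fun k => ((Measure.measurable_coe (measurableSet_singleton k)).comp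
    measurable_subtype_coe).const_mul _

theorem lintegral_offspring (F : OffspringLaw) (f : ℕ → ℝ≥0∞) :
    ∫⁻ k, f k ∂(F : Measure ℕ) = ∑' k, f k * (F : Measure ℕ) {k} := lintegral_countable' f

/-- A weak form of Bonferroni's inequality for the probability of at least one success. -/
theorem mul_le_one_sub_pow_add {σ : ℝ} (h0 : 0 ≤ σ) (h1 : σ ≤ 1) (k : ℕ) :
    k * σ ≤ 1 - (1 - σ) ^ k + ((k * (k - 1) : ℕ) : ℝ) * σ ^ 2 := by
  induction k with
  | zero => simp
  | succ k ih =>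
    have hk : ((k * (k - 1) : ℕ) : ℝ) = k * (k - 1) := by
      cases k <;> simp
    have hk' : (((k + 1) * (k + 1 - 1) : ℕ) : ℝ) = (k + 1) * k := by
      simp
    rw [hk] at ih
    rw [hk', pow_succ]
    push_cast
    have hk0 : (0 : ℝ) ≤ k := Nat.cast_nonneg k
    have h2 : (1 - σ) ^ k ≤ 1 - k * σ + k * (k - 1) * σ ^ 2 := by linarith
    have h3 := mul_le_mul_of_nonneg_right h2 (sub_nonneg.2 h1)
    have h4 : 0 ≤ (k : ℝ) * (k - 1) * σ ^ 3 := by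
      rcases Nat.eq_zero_or_pos k with rfl | hk1
      · simp
      · have : (1 : ℝ) ≤ k := by exact_mod_cast hk1
        have := sub_nonneg.2 this
        positivity
    nlinarith [mul_nonneg hk0 (sq_nonneg σ)]

theorem one_sub_pow_le_mul (t : ℝ≥0∞) (ht : t ≤ 1) (k : ℕ) : 1 - t ^ k ≤ k * (1 - t) := by
  rw [tsub_le_iff_right]
  induction k with
  | zero => simp
  | succ k ih =>
    have h1 : (1 : ℝ≥0∞) ≤ (1 - t) + t := by rw [tsub_add_cancel_of_le ht]
    calc (1 : ℝ≥0∞) ≤ (1 - t) + t * 1 := by rwa [mul_one]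
      _ ≤ (1 - t) + t * (k * (1 - t) + t ^ k) := by gcongr
      _ = (1 - t) + t * (k * (1 - t)) + t ^ (k + 1) := by ring
      _ ≤ (1 - t) + 1 * (k * (1 - t)) + t ^ (k + 1) := by gcongr
      _ = _ := by push_cast; ring

theorem mul_le_one_sub_pow_add' {s : ℝ≥0∞} (hs : s ≤ 1) (k : ℕ) :
    k * s ≤ (1 - (1 - s) ^ k) + ((k * (k - 1) : ℕ) : ℝ≥0∞) * s ^ 2 := by
  have hfin : s ≠ ∞ := (hs.trans_lt ENNReal.one_lt_top).ne
  set σ := s.toReal with hσ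
  have hsσ : s = ENNReal.ofReal σ := (ENNReal.ofReal_toReal hfin).symm
  have h0 : 0 ≤ σ := ENNReal.toReal_nonneg
  have h1 : σ ≤ 1 := ENNReal.toReal_le_of_le_ofReal zero_le_one (by simpa using hs)
  have h2 : 0 ≤ (1 - σ) ^ k := pow_nonneg (sub_nonneg.2 h1) k
  have h3 : (1 - σ) ^ k ≤ 1 := pow_le_one₀ (sub_nonneg.2 h1) (by linarith)
  rw [hsσ, ← ENNReal.ofReal_one, ← ENNReal.ofReal_sub _ h0,
    ← ENNReal.ofReal_pow (sub_nonneg.2 h1), ← ENNReal.ofReal_sub _ h2, ← ENNReal.ofReal_pow h0,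
    ← ENNReal.ofReal_natCast, ← ENNReal.ofReal_natCast, ← ENNReal.ofReal_mul (Nat.cast_nonneg _),
    ← ENNReal.ofReal_mul (Nat.cast_nonneg _),
    ← ENNReal.ofReal_add (sub_nonneg.2 h3) (by positivity)]
  exact ENNReal.ofReal_le_ofReal (mul_le_one_sub_pow_add h0 h1 k)

theorem lintegral_one_sub_pow_le (F : OffspringLaw) {t : ℝ≥0∞} (ht : t ≤ 1) :
    ∫⁻ k, (1 - t ^ k) ∂(F : Measure ℕ) ≤ offspringMean F * (1 - t) := by
  rw [lintegral_offspring, offspringMean, ← ENNReal.tsum_mul_right]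
  refine ENNReal.tsum_le_tsum fun k => ?_
  calc (1 - t ^ k) * (F : Measure ℕ) {k} ≤ (k * (1 - t)) * (F : Measure ℕ) {k} :=
        mul_le_mul_left (one_sub_pow_le_mul t ht k) _
    _ = _ := by ring

/-- A second moment bound for survival through one generation: if each of the children, whose number
has law `F`, succeeds independently with probability `s`, and `η (mean) s ≤ b`, then one of them
succeeds with probability at least `(mean) s / (1 + b) ^ 2`. -/
theorem le_lintegral_one_sub_pow {F : OffspringLaw} (h0 : offspringMean F ≠ 0)
    (htop : offspringMean F ≠ ∞) {s b : ℝ≥0∞} (hs : s ≤ 1) (hb : b ≠ ∞)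
    (h : factorialMoment F * (offspringMean F * s) ≤ b) :
    ((1 + b) ^ 2)⁻¹ * (offspringMean F * s) ≤ ∫⁻ k, (1 - (1 - s) ^ k) ∂(F : Measure ℕ) := by
  set a := offspringMean F with ha
  set m₂ := ∑' k : ℕ, ((k * (k - 1) : ℕ) : ℝ≥0∞) * (F : Measure ℕ) {k} with hm₂
  have hm₂a : m₂ * s ≤ b * a := by
    have h1 : factorialMoment F = m₂ / a ^ 2 := rfl
    have h2 : m₂ = factorialMoment F * a ^ 2 := by
      rw [h1, ENNReal.div_mul_cancel (pow_ne_zero 2 h0) (ENNReal.pow_ne_top htop)]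
    calc m₂ * s = factorialMoment F * (a * s) * a := by rw [h2]; ring
      _ ≤ b * a := by gcongr
  have hb1 : 1 + b ≠ ∞ := ENNReal.add_ne_top.2 ⟨ENNReal.one_ne_top, hb⟩
  have hb0 : 1 + b ≠ 0 := (lt_of_lt_of_le one_pos le_self_add).ne'
  set d := (1 + b)⁻¹ with hd
  have hd1 : d * (1 + b) = 1 := ENNReal.inv_mul_cancel hb0 hb1
  have hdle : d ≤ 1 := ENNReal.inv_le_one.2 le_self_add
  -- thinning the successes by the factor `d` makes the quadratic term smaller than the linear one
  set σ := d * s with hσ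
  have hσs : σ ≤ s := mul_le_of_le_one_left zero_le hdle
  have h3 : a * σ ≤ ∫⁻ k, (1 - (1 - s) ^ k) ∂(F : Measure ℕ) + m₂ * σ ^ 2 := by
    rw [lintegral_offspring, hm₂, ha, offspringMean, ← ENNReal.tsum_mul_right,
      ← ENNReal.tsum_mul_right, ← ENNReal.tsum_add]
    refine ENNReal.tsum_le_tsum fun k => ?_
    calc (k : ℝ≥0∞) * (F : Measure ℕ) {k} * σ = k * σ * (F : Measure ℕ) {k} := by ring
      _ ≤ ((1 - (1 - σ) ^ k) + ((k * (k - 1) : ℕ) : ℝ≥0∞) * σ ^ 2) * (F : Measure ℕ) {k} :=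
          mul_le_mul_left (mul_le_one_sub_pow_add' (hσs.trans hs) k) _
      _ ≤ ((1 - (1 - s) ^ k) + ((k * (k - 1) : ℕ) : ℝ≥0∞) * σ ^ 2) * (F : Measure ℕ) {k} := by
          gcongr
      _ = _ := by ring
  have h4 : m₂ * σ ^ 2 ≤ d * b * (a * σ) := by
    calc m₂ * σ ^ 2 = m₂ * s * (d * σ) := by rw [hσ]; ring
      _ ≤ b * a * (d * σ) := by gcongr
      _ = _ := by ring
  have hfin : d * b * (a * σ) ≠ ∞ := by
    refine ENNReal.mul_ne_top (ENNReal.mul_ne_top (hdle.trans_lt ENNReal.one_lt_top).ne hb)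
      (ENNReal.mul_ne_top htop ?_)
    exact ((hσs.trans hs).trans_lt ENNReal.one_lt_top).ne
  have h5 : a * σ = d * (a * σ) + d * b * (a * σ) := by
    calc a * σ = d * (1 + b) * (a * σ) := by rw [hd1, one_mul]
      _ = _ := by ring
  have h6 : d * (a * σ) + d * b * (a * σ) ≤
      ∫⁻ k, (1 - (1 - s) ^ k) ∂(F : Measure ℕ) + d * b * (a * σ) := by
    rw [← h5]; exact h3.trans (by gcongr)
  calc ((1 + b) ^ 2)⁻¹ * (a * s) = d * (a * σ) := by
        rw [hσ, ENNReal.inv_pow]; ring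
    _ ≤ _ := (ENNReal.add_le_add_iff_right hfin).1 h6

/-! ### Hitting probabilities -/

/-- The quenched probability of reaching the level at distance `y` within `N` generations. -/
noncomputable def hitProb (μ : Measure ℤ) (N : ℕ) (e : FutureEnv) (y : ℤ) : ℝ≥0∞ :=
  1 - noHit μ N e y

variable {μ : Measure ℤ}

theorem hitProb_le_one (N : ℕ) (e : FutureEnv) (y : ℤ) : hitProb μ N e y ≤ 1 := tsub_le_self

theorem hitProb_of_nonpos (N : ℕ) (e : FutureEnv) {y : ℤ} (hy : y ≤ 0) : hitProb μ N e y = 1 := by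
  cases N <;> simp [hitProb, noHit, hy]

theorem hitProb_zero_of_pos (e : FutureEnv) {y : ℤ} (hy : 0 < y) : hitProb μ 0 e y = 0 := by
  simp [hitProb, noHit, hy.not_ge]

variable [IsProbabilityMeasure μ]

theorem measurable_hitProb (N : ℕ) (y : ℤ) : Measurable fun e => hitProb μ N e y :=
  measurable_const.sub (measurable_noHit μ N y)

theorem lintegral_hitProb_le_one (N : ℕ) (e : FutureEnv) (y : ℤ) :
    ∫⁻ h, hitProb μ N e (y - h) ∂μ ≤ 1 :=
  (lintegral_mono fun h => hitProb_le_one N e (y - h)).trans (by simp)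

theorem hitProb_succ (N : ℕ) (e : FutureEnv) {y : ℤ} (hy : 0 < y) :
    hitProb μ (N + 1) e y =
      ∫⁻ k, (1 - (1 - ∫⁻ h, hitProb μ N (shift e) (y - h) ∂μ) ^ k) ∂(e 0 : Measure ℕ) := by
  have hle : ∫⁻ h, noHit μ N (shift e) (y - h) ∂μ ≤ 1 :=
    (lintegral_mono fun h => noHit_le_one μ N _ _).trans (by simp)
  have h1 : 1 - ∫⁻ h, hitProb μ N (shift e) (y - h) ∂μ = ∫⁻ h, noHit μ N (shift e) (y - h) ∂μ := by
    have : ∫⁻ h, hitProb μ N (shift e) (y - h) ∂μ =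
        1 - ∫⁻ h, noHit μ N (shift e) (y - h) ∂μ := by
      simp only [hitProb]
      rw [lintegral_sub (measurable_of_countable _) (hle.trans_lt ENNReal.one_lt_top).ne
        (ae_of_all _ fun h => noHit_le_one μ N _ _)]
      simp
    rw [this, ENNReal.sub_sub_cancel ENNReal.one_ne_top hle]
  rw [h1, hitProb]
  simp only [noHit, hy.not_ge, if_false]
  have hpow : ∀ k, (∫⁻ h, noHit μ N (shift e) (y - h) ∂μ) ^ k ≤ 1 := fun k =>
    pow_le_one₀ zero_le hle
  have hfin : ∫⁻ k, (∫⁻ h, noHit μ N (shift e) (y - h) ∂μ) ^ k ∂(e 0 : Measure ℕ) ≠ ∞ := by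
    refine ne_top_of_le_ne_top ENNReal.one_ne_top ((lintegral_mono hpow).trans ?_)
    simp
  rw [lintegral_sub (measurable_of_countable _) hfin (ae_of_all _ hpow)]
  simp

end

section
/-! ### Comparison of hitting probabilities with the biased walk -/

/-- The jump law `ν` is `μ` biased by `h ↦ a e^{l h}`. -/
def IsBias (μ ν : Measure ℤ) (l : ℝ) (a : ℝ≥0∞) : Prop :=
  ∀ f : ℤ → ℝ≥0∞, ∫⁻ h, f h ∂ν = a * ∫⁻ h, expWeight l h * f h ∂μ

/-- The hitting probability multiplied by `e^{l y}`. -/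
noncomputable def normHit (μ : Measure ℤ) (l : ℝ) (N : ℕ) (e : FutureEnv) (y : ℤ) : ℝ≥0∞ :=
  expWeight l y * hitProb μ N e y

/-- The mean offspring number divided by `a`. -/
noncomputable def biasedMean (a : ℝ≥0∞) (F : OffspringLaw) : ℝ≥0∞ := offspringMean F / a

theorem measurable_biasedMean (a : ℝ≥0∞) : Measurable (biasedMean a) :=
  measurable_offspringMean.div_const a

variable {μ ν : Measure ℤ} {l : ℝ} {a : ℝ≥0∞}

theorem normHit_of_nonpos (N : ℕ) (e : FutureEnv) {y : ℤ} (hy : y ≤ 0) :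
    normHit μ l N e y = expWeight l y := by
  rw [normHit, hitProb_of_nonpos N e hy, mul_one]

theorem normHit_zero_of_pos (e : FutureEnv) {y : ℤ} (hy : 0 < y) : normHit μ l 0 e y = 0 := by
  rw [normHit, hitProb_zero_of_pos e hy, mul_zero]

theorem IsBias.mul_lintegral (h : IsBias μ ν l a) (ha0 : a ≠ 0) (ha : a ≠ ∞) (F : OffspringLaw)
    (f : ℤ → ℝ≥0∞) (y : ℤ) :
    biasedMean a F * ∫⁻ h, expWeight l (y - h) * f (y - h) ∂ν =
      expWeight l y * (offspringMean F * ∫⁻ h, f (y - h) ∂μ) := by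
  rw [h fun h => expWeight l (y - h) * f (y - h)]
  have h1 : ∀ h : ℤ, expWeight l h * (expWeight l (y - h) * f (y - h)) =
      expWeight l y * f (y - h) := by
    intro h
    rw [expWeight_sub]
    calc _ = expWeight l y * (expWeight l h * expWeight l (-h)) * f (y - h) := by ring
      _ = _ := by rw [expWeight_mul_neg, mul_one]
  simp_rw [h1]
  rw [lintegral_const_mul _ (measurable_of_countable _), ← mul_assoc, biasedMean,
    ENNReal.div_mul_cancel ha0 ha]
  ring

variable [IsProbabilityMeasure μ]

theorem measurable_normHit (N : ℕ) (y : ℤ) : Measurable fun e => normHit μ l N e y :=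
  (measurable_hitProb N y).const_mul _

theorem normHit_succ_le (h : IsBias μ ν l a) (ha0 : a ≠ 0) (ha : a ≠ ∞) (N : ℕ) (e : FutureEnv)
    {y : ℤ} (hy : 0 < y) :
    normHit μ l (N + 1) e y ≤ biasedMean a (e 0) * ∫⁻ h, normHit μ l N (shift e) (y - h) ∂ν := by
  simp only [normHit]
  rw [h.mul_lintegral ha0 ha (e 0) (hitProb μ N (shift e)) y, hitProb_succ N e hy]
  gcongr
  refine (lintegral_one_sub_pow_le (e 0) tsub_le_self).trans ?_
  rw [ENNReal.sub_sub_cancel ENNReal.one_ne_top (lintegral_hitProb_le_one N _ y)]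

theorem normHit_le_expectedHits (hν : ∀ᵐ h ∂ν, h ≤ 1) (h : IsBias μ ν l a) (ha0 : a ≠ 0)
    (ha : a ≠ ∞) (N : ℕ) (e : FutureEnv) {y : ℤ} (hy : 0 ≤ y) :
    normHit μ l N e y ≤ expectedHits ν (biasedMean a) e y := by
  induction N generalizing e y with
  | zero =>
    rcases hy.eq_or_lt with rfl | hy
    · rw [normHit_of_nonpos _ _ le_rfl, expectedHits_zero, expWeight_zero_right]
    · rw [normHit_zero_of_pos _ hy]; exact zero_le
  | succ N ih =>
    rcases hy.eq_or_lt with rfl | hy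
    · rw [normHit_of_nonpos _ _ le_rfl, expectedHits_zero, expWeight_zero_right]
    · refine (normHit_succ_le h ha0 ha N e hy).trans ?_
      rw [expectedHits_of_pos e hy]
      refine mul_le_mul_right (lintegral_mono_ae (hν.mono fun h' hh => ?_)) _
      exact ih _ (by omega)

/-- A vertex with `η v = x`, where `v` is the expected number of hits, loses at most a factor
`(1 + x) ^ 2` compared with the first moment. -/
theorem le_normHit_succ (hν : ∀ᵐ h ∂ν, h ≤ 1) (h : IsBias μ ν l a) (ha0 : a ≠ 0)
    (ha : a ≠ ∞) (N : ℕ) {e : FutureEnv} (he : 0 < offspringMean (e 0) ∧ offspringMean (e 0) < ∞)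
    {y : ℤ} (hy : 0 < y) {x : ℝ≥0∞}
    (hx : factorialMoment (e 0) * (expWeight l (-y) * expectedHits ν (biasedMean a) e y) = x) :
    ((1 + x) ^ 2)⁻¹ * (biasedMean a (e 0) * ∫⁻ h, normHit μ l N (shift e) (y - h) ∂ν) ≤
      normHit μ l (N + 1) e y := by
  rcases eq_or_ne x ∞ with hxt | hxt
  · simp [hxt]
  set s := ∫⁻ h, hitProb μ N (shift e) (y - h) ∂μ with hs
  have hkey := h.mul_lintegral ha0 ha (e 0) (hitProb μ N (shift e)) y
  have hle : offspringMean (e 0) * s ≤ expWeight l (-y) * expectedHits ν (biasedMean a) e y := by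
    rw [expectedHits_of_pos e hy]
    calc offspringMean (e 0) * s
        = expWeight l (-y) * (expWeight l y * (offspringMean (e 0) * s)) := by
          rw [← mul_assoc, mul_comm (expWeight l (-y)), expWeight_mul_neg, one_mul]
      _ ≤ _ := by
          rw [← hkey]
          refine mul_le_mul_right (mul_le_mul_right
            (lintegral_mono_ae (hν.mono fun h' hh => ?_)) _) _
          exact normHit_le_expectedHits hν h ha0 ha N _ (by omega)
  simp only [normHit]
  rw [hkey, hitProb_succ N e hy, mul_left_comm]
  gcongr
  refine le_lintegral_one_sub_pow he.1.ne' he.2.ne (lintegral_hitProb_le_one N _ y) hxt ?_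
  rw [← hx]
  gcongr

/-- The factor lost along a good line of descent of length `n`. -/
noncomputable def lossFactor (b : ℕ → ℝ≥0∞) (n : ℕ) : ℝ≥0∞ :=
  ∏ j ∈ Finset.range n, ((1 + b (j + 1)) ^ 2)⁻¹

theorem sum_goodHits_le_normHit (hν : ∀ᵐ h ∂ν, h ≤ 1) (h : IsBias μ ν l a) (ha0 : a ≠ 0)
    (ha : a ≠ ∞) (b : ℕ → ℝ≥0∞) (N : ℕ) {e : FutureEnv}
    (he : ∀ k, 0 < offspringMean (e k) ∧ offspringMean (e k) < ∞) {y : ℤ} (hy : 0 ≤ y) :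
    ∑ n ∈ Finset.range (N + 1), lossFactor b n * goodHits ν (biasedMean a)
      (badSet ν (biasedMean a) factorialMoment l b) n e y ≤ normHit μ l N e y := by
  set B := badSet ν (biasedMean a) factorialMoment l b with hB
  induction N generalizing e y with
  | zero =>
    rcases hy.eq_or_lt with rfl | hy
    · simp [goodHits, lossFactor, normHit_of_nonpos, expWeight_zero_right]
    · simp [goodHits, hy.ne']
  | succ N ih =>
    rcases hy.eq_or_lt with rfl | hy
    · rw [Finset.sum_range_succ']
      simp [goodHits, lossFactor, normHit_of_nonpos, expWeight_zero_right]
    rw [Finset.sum_range_succ']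
    set x := factorialMoment (e 0) * (expWeight l (-y) * expectedHits ν (biasedMean a) e y) with hx
    have hterm : ∀ n, lossFactor b (n + 1) * goodHits ν (biasedMean a) B (n + 1) e y ≤
        ((1 + x) ^ 2)⁻¹ * (biasedMean a (e 0) *
          ∫⁻ h, lossFactor b n * goodHits ν (biasedMean a) B n (shift e) (y - h) ∂ν) := by
      intro n
      rw [lintegral_const_mul _ (measurable_of_countable _), lossFactor, Finset.prod_range_succ]
      simp only [goodHits, hy, if_true]
      by_cases hbad : e ∈ B (n + 1) y
      · simp [hbad]
      · rw [Set.indicator_of_mem (show e ∈ (B (n + 1) y)ᶜ from hbad)]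
        have hxb : x ≤ b (n + 1) := not_lt.1 hbad
        calc _ ≤ (∏ j ∈ Finset.range n, ((1 + b (j + 1)) ^ 2)⁻¹) * ((1 + x) ^ 2)⁻¹ *
              (biasedMean a (e 0) *
                ∫⁻ h, goodHits ν (biasedMean a) B n (shift e) (y - h) ∂ν) := by gcongr
          _ = _ := by rw [lossFactor]; ring
    have h0 : goodHits ν (biasedMean a) B 0 e y = 0 := by simp [goodHits, hy.ne']
    rw [h0, mul_zero, add_zero]
    calc _ ≤ ∑ n ∈ Finset.range (N + 1), ((1 + x) ^ 2)⁻¹ * (biasedMean a (e 0) *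
          ∫⁻ h, lossFactor b n * goodHits ν (biasedMean a) B n (shift e) (y - h) ∂ν) :=
          Finset.sum_le_sum fun n _ => hterm n
      _ = ((1 + x) ^ 2)⁻¹ * (biasedMean a (e 0) * ∫⁻ h, ∑ n ∈ Finset.range (N + 1),
            lossFactor b n * goodHits ν (biasedMean a) B n (shift e) (y - h) ∂ν) := by
          rw [lintegral_finsetSum _ fun _ _ => measurable_of_countable _, Finset.mul_sum,
            Finset.mul_sum]
      _ ≤ ((1 + x) ^ 2)⁻¹ *
            (biasedMean a (e 0) * ∫⁻ h, normHit μ l N (shift e) (y - h) ∂ν) := by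
          refine mul_le_mul_right (mul_le_mul_right
            (lintegral_mono_ae (hν.mono fun h' hh => ?_)) _) _
          exact ih (e := shift e) (fun k => he (k + 1)) (by omega)
      _ ≤ _ := le_normHit_succ hν h ha0 ha N (he 0) hy hx.symm

theorem exists_pos_le_lossFactor {c : ℝ} (hc : 0 < c) (M : ℕ) :
    ∃ κ : ℝ≥0∞, 0 < κ ∧ ∀ n, κ ≤ lossFactor (threshold c M) n := by
  set β : ℕ → ℝ := fun j => Real.exp (c * (2 * M - (j + 1 : ℕ))) with hβ
  have hβs : Summable β := by
    have h1 : Summable fun j : ℕ => Real.exp (c * (2 * M - 1)) * Real.exp (-c) ^ j :=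
      (summable_geometric_of_lt_one (Real.exp_nonneg _)
        (Real.exp_lt_one_iff.2 (by linarith))).mul_left _
    refine h1.congr fun j => ?_
    rw [hβ, ← Real.exp_nat_mul, ← Real.exp_add]
    congr 1; push_cast; ring
  refine ⟨eexp (-(2 * ∑' j, β j)), eexp_pos _, fun n => ?_⟩
  have h2 : ∀ j, eexp (-(2 * β j)) ≤ ((1 + threshold c M (j + 1)) ^ 2)⁻¹ := by
    intro j
    rw [eexp_neg, ENNReal.inv_le_inv]
    calc (1 + threshold c M (j + 1)) ^ 2 = ENNReal.ofReal (1 + β j) ^ 2 := by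
          rw [ENNReal.ofReal_add zero_le_one (Real.exp_nonneg _), ENNReal.ofReal_one]; rfl
      _ ≤ eexp (β j) ^ 2 := by
          gcongr
          exact ENNReal.ofReal_le_ofReal (by rw [add_comm]; exact Real.add_one_le_exp _)
      _ = _ := by rw [eexp_pow]; norm_num
  calc eexp (-(2 * ∑' j, β j)) ≤ eexp (∑ j ∈ Finset.range n, -(2 * β j)) := by
        refine eexp_mono ?_
        rw [Finset.sum_neg_distrib, ← Finset.mul_sum]
        have := hβs.sum_le_tsum (Finset.range n) fun j _ => Real.exp_nonneg _
        linarith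
    _ = ∏ j ∈ Finset.range n, eexp (-(2 * β j)) := by
        induction n with
        | zero => simp [eexp_zero]
        | succ n ih => rw [Finset.sum_range_succ, Finset.prod_range_succ, eexp_add, ih]
    _ ≤ _ := Finset.prod_le_prod' fun j _ => h2 j

variable {E : Measure OffspringLaw} [IsProbabilityMeasure E]

/-- The maximum principle behind monotonicity: a line of descent that climbs from distance `z` to
`0` has to pass through distance `x ≤ z`. -/
theorem lintegral_normHit_le_iSup [IsProbabilityMeasure ν] (hν : ∀ᵐ h ∂ν, h ≤ 1)
    (h : IsBias μ ν l a) (ha0 : a ≠ 0) (ha : a ≠ ∞) (hE : ∫⁻ F, biasedMean a F ∂E = 1)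
    {x z : ℤ} (hx : 0 ≤ x) (hz : x ≤ z) (N : ℕ) :
    ∫⁻ e, normHit μ l N e z ∂futureLaw E ≤ ⨆ n, ∫⁻ e, normHit μ l n e x ∂futureLaw E := by
  induction N generalizing z with
  | zero =>
    rcases hz.eq_or_lt with rfl | hz
    · exact le_iSup (fun n => ∫⁻ e, normHit μ l n e x ∂futureLaw E) 0
    · simp [normHit_zero_of_pos _ (hx.trans_lt hz)]
  | succ N ih =>
    rcases hz.eq_or_lt with rfl | hz
    · exact le_iSup (fun n => ∫⁻ e, normHit μ l n e x ∂futureLaw E) (N + 1)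
    have hm := fun y => measurable_normHit (μ := μ) (l := l) N y
    calc ∫⁻ e, normHit μ l (N + 1) e z ∂futureLaw E
        ≤ ∫⁻ e, biasedMean a (e 0) * ∫⁻ h, normHit μ l N (shift e) (z - h) ∂ν ∂futureLaw E :=
          lintegral_mono fun e => normHit_succ_le h ha0 ha N e (hx.trans_lt hz)
      _ = ∫⁻ h, ∫⁻ e, normHit μ l N e (z - h) ∂futureLaw E ∂ν := by
          rw [lintegral_env_split E (measurable_biasedMean a)
            (measurable_lintegral_int (ν := ν) hm z), hE, one_mul]
          simp_rw [lintegral_countable']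
          rw [lintegral_tsum fun h => ((hm _).mul_const _).aemeasurable]
          exact tsum_congr fun h => lintegral_mul_const _ (hm _)
      _ ≤ ∫⁻ _, ⨆ n, ∫⁻ e, normHit μ l n e x ∂futureLaw E ∂ν :=
          lintegral_mono_ae (hν.mono fun h' hh => ih (by omega))
      _ = _ := by simp

theorem le_iSup_lintegral_normHit [IsProbabilityMeasure ν] (hν : ∀ᵐ h ∂ν, h ≤ 1)
    (hl : 0 ≤ l) (hρ : ∫⁻ h, expWeight l (-h) ∂ν < 1)
    (h : IsBias μ ν l a) (ha0 : a ≠ 0) (ha : a ≠ ∞) (hE : ∫⁻ F, biasedMean a F ∂E = 1)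
    (hpos : ∀ᵐ F ∂E, 0 < offspringMean F ∧ offspringMean F < ∞)
    (hlog : ∫⁻ F, biasedMean a F * logPlus (factorialMoment F) ∂E < ∞)
    {θ : ℝ} (hθ0 : 0 < θ) (hθ1 : θ ≤ 1) (hφ : 1 ≤ ∫⁻ F, biasedMean a F ^ (1 + θ) ∂E)
    (hφψ : (∫⁻ F, biasedMean a F ^ (1 + θ) ∂E) * ∫⁻ h, expWeight (θ * l) (-h) ∂ν < 1) :
    ∃ κ : ℝ≥0∞, 0 < κ ∧ ∀ x : ℤ, 0 ≤ x → κ ≤ ⨆ N, ∫⁻ e, normHit μ l N e x ∂futureLaw E := by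
  set ρ := ∫⁻ h, expWeight l (-h) ∂ν with hρdef
  have hm := measurable_biasedMean a
  have hηm := measurable_factorialMoment
  have hε : 0 < (1 - ρ) * (1 / 2) :=
    ENNReal.mul_pos (tsub_pos_of_lt hρ).ne' (by norm_num)
  obtain ⟨c, hc, M, hM⟩ := exists_threshold hν hl hρ hm hE hηm hlog hθ0 hθ1 hφ hφψ hε
  obtain ⟨κ, hκ, hκle⟩ := exists_pos_le_lossFactor hc M
  refine ⟨κ * (1 / 2), ENNReal.mul_pos hκ.ne' (by norm_num), fun x hx => ?_⟩
  set B := badSet ν (biasedMean a) factorialMoment l (threshold c M) with hB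
  have hBm : ∀ j y, MeasurableSet (B j y) := fun j y => measurableSet_badSet hm hηm _ _ j y
  have hsmall : (1 - ρ)⁻¹ * ∑' w, ∑' j, badMass E ν (biasedMean a) B (j + 1) w ≤ 1 / 2 := by
    calc _ ≤ (1 - ρ)⁻¹ * ((1 - ρ) * (1 / 2)) := by gcongr
      _ = 1 / 2 := by
        rw [← mul_assoc, ENNReal.inv_mul_cancel (tsub_pos_of_lt hρ).ne'
          (ENNReal.sub_ne_top ENNReal.one_ne_top), one_mul]
  have hhalf := half_le_tsum_goodHits hν hl hρ hm hE hBm hsmall hx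
  have hg := fun n => measurable_goodHits (ν := ν) hm hBm n x
  calc κ * (1 / 2) ≤ κ * ∑' n, ∫⁻ e, goodHits ν (biasedMean a) B n e x ∂futureLaw E := by gcongr
    _ = ⨆ N, ∑ n ∈ Finset.range (N + 1),
          κ * ∫⁻ e, goodHits ν (biasedMean a) B n e x ∂futureLaw E := by
        rw [← ENNReal.tsum_mul_left]
        exact ENNReal.tsum_eq_iSup_nat' (tendsto_add_atTop_nat 1)
    _ ≤ _ := by
        refine iSup_mono fun N => ?_
        simp_rw [← fun n => lintegral_const_mul (μ := futureLaw E) κ (hg n)]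
        rw [← lintegral_finsetSum _ fun n _ => (hg n).const_mul _]
        refine lintegral_mono_ae ((ae_env_of_ae hpos).mono fun e he => ?_)
        refine le_trans (Finset.sum_le_sum fun n _ => ?_)
          (sum_goodHits_le_normHit hν h ha0 ha (threshold c M) N he hx)
        exact mul_le_mul_left (hκle n) _

end

/-! ### The exponents -/

section Exponents

variable {E : Measure OffspringLaw} {μ : Measure ℤ}

theorem Subcritical.biasedMean_eq (hE : Subcritical E) (L : ℝ) :
    ∀ᵐ F ∂E, biasedMean (eexp L) F = eexp (logMean F - L) := by
  filter_upwards [hE.mean_pos_finite] with F hF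
  rw [biasedMean, sub_eq_add_neg, eexp_add, eexp_neg, ← div_eq_mul_inv]
  congr 1
  rw [eexp, logMean, Real.exp_log (ENNReal.toReal_pos hF.1.ne' hF.2.ne),
    ENNReal.ofReal_toReal hF.2.ne]

theorem JumpAssumption.ae_le_one (hμ : JumpAssumption μ) : ∀ᵐ h ∂μ, h ≤ 1 := by
  rw [ae_iff]
  refine measure_mono_null (fun h hh => ?_) hμ.no_big_jump
  have : ¬ h ≤ 1 := hh
  exact Set.mem_Ici.2 (by omega)

theorem IsBias.lintegral_expWeight_neg {ν : Measure ℤ} {l : ℝ} {a : ℝ≥0∞} (h : IsBias μ ν l a)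
    (s : ℝ) : ∫⁻ h, expWeight s (-h) ∂ν = a * ∫⁻ h, expWeight (l - s) h ∂μ := by
  rw [h]
  congr 1
  refine lintegral_congr fun h => ?_
  refine (eexp_add _ _).symm.trans ?_
  rw [expWeight, eexp]
  congr 2; push_cast; ring

variable [IsProbabilityMeasure μ]

theorem JumpAssumption.integrable_exp (hμ : JumpAssumption μ) {l : ℝ} (hl : 0 ≤ l) :
    Integrable (fun h : ℤ => Real.exp (l * h)) μ := by
  refine Integrable.of_bound (measurable_of_countable _).aestronglyMeasurable (Real.exp l) ?_
  filter_upwards [hμ.ae_le_one] with h hh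
  rw [Real.norm_eq_abs, abs_of_pos (Real.exp_pos _), Real.exp_le_exp]
  have : (h : ℝ) ≤ 1 := by exact_mod_cast hh
  nlinarith

theorem JumpAssumption.exp_LamS (hμ : JumpAssumption μ) {l : ℝ} (hl : 0 ≤ l) :
    Real.exp (LamS μ l) = ∫ h : ℤ, Real.exp (l * h) ∂μ :=
  exp_cgf (hμ.integrable_exp hl)

theorem JumpAssumption.lintegral_expWeight (hμ : JumpAssumption μ) {l : ℝ} (hl : 0 ≤ l) :
    ∫⁻ h, expWeight l h ∂μ = eexp (LamS μ l) := by
  rw [eexp, hμ.exp_LamS hl, ofReal_integral_eq_lintegral_ofReal (hμ.integrable_exp hl)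
    (ae_of_all _ fun F => Real.exp_nonneg _)]
  rfl

theorem JumpAssumption.isBias_tilted (hμ : JumpAssumption μ) {l : ℝ} (hl : 0 ≤ l) :
    IsBias μ (μ.tilted fun h => l * (h : ℝ)) l (eexp (-LamS μ l)) := by
  intro f
  rw [lintegral_tilted, ← lintegral_const_mul' _ _ (eexp_ne_top _)]
  refine lintegral_congr fun h => ?_
  rw [← hμ.exp_LamS hl, ← Real.exp_sub, sub_eq_neg_add, ← mul_assoc]
  congr 1
  exact eexp_add _ _

/-- The condition `Θ(1) < 0` says that a fractional moment of the size of the progeny, seen from the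
end of a line of descent, decreases geometrically. -/
theorem exists_fractional_exponent (hE : Subcritical E) (hμ : JumpAssumption μ) {l : ℝ}
    (hl : 0 < l) (hlam : LamE E 1 + LamS μ l = 0) (hΘ : theta1 E μ l < 0) :
    ∃ θ : ℝ, 0 < θ ∧ θ ≤ 1 ∧
      LamE E (1 + θ) - (1 + θ) * LamE E 1 + (LamE E 1 + LamS μ (l - θ * l)) < 0 := by
  have hdE : HasDerivAt (LamE E) (deriv (LamE E) 1) 1 := by
    have hmem : (1 : ℝ) ∈ interior (integrableExpSet logMean E) := by
      refine mem_interior.2 ⟨Set.Ioi 0, fun ρ hρ => ?_, isOpen_Ioi, Set.mem_Ioi.2 one_pos⟩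
      exact hE.integrable_exp ρ (le_of_lt hρ)
    exact (analyticAt_cgf hmem).differentiableAt.hasDerivAt
  have hdS : HasDerivAt (LamS μ) (deriv (LamS μ) l) l := by
    have hmem : l ∈ interior (integrableExpSet (fun h : ℤ => (h : ℝ)) μ) := by
      refine mem_interior.2 ⟨Set.Ioi 0, fun ρ hρ => ?_, isOpen_Ioi, Set.mem_Ioi.2 hl⟩
      exact hμ.integrable_exp (le_of_lt hρ)
    exact (analyticAt_cgf hmem).differentiableAt.hasDerivAt
  set g : ℝ → ℝ := fun θ =>
    LamE E (1 + θ) - (1 + θ) * LamE E 1 + (LamE E 1 + LamS μ (l - θ * l)) with hg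
  have hder : HasDerivAt g (theta1 E μ l) 0 := by
    have h1 : HasDerivAt (fun θ : ℝ => 1 + θ) 1 0 := (hasDerivAt_id 0).const_add 1
    have h2 : HasDerivAt (fun θ : ℝ => l - θ * l) (-(1 * l)) 0 :=
      ((hasDerivAt_id (0 : ℝ)).mul_const l).const_sub l
    have h3 : HasDerivAt (fun θ : ℝ => LamE E (1 + θ)) (deriv (LamE E) 1 * 1) 0 :=
      HasDerivAt.comp (h₂ := LamE E) 0 (by simpa using hdE) h1
    have h4 : HasDerivAt (fun θ : ℝ => LamS μ (l - θ * l)) (deriv (LamS μ) l * -(1 * l)) 0 :=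
      HasDerivAt.comp (h₂ := LamS μ) 0 (by simpa using hdS) h2
    have h5 := (h3.sub (h1.mul_const (LamE E 1))).add (h4.const_add (LamE E 1))
    refine h5.congr_deriv ?_
    rw [theta1]
    linear_combination (-1 : ℝ) * hlam
  have hg0 : g 0 = 0 := by
    simp only [hg, add_zero, zero_mul, sub_zero, one_mul]
    linarith
  have hslope : Tendsto (slope g 0) (𝓝[>] 0) (𝓝 (theta1 E μ l)) :=
    (hasDerivAt_iff_tendsto_slope.1 hder).mono_left
      (nhdsWithin_mono 0 fun _ hx => ne_of_gt (Set.mem_Ioi.1 hx))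
  obtain ⟨θ, ⟨hneg, hθ1⟩, hθ0⟩ := ((((hslope.eventually_lt_const hΘ)).and
    (mem_nhdsWithin_of_mem_nhds (Iic_mem_nhds (zero_lt_one' ℝ)))).and
      self_mem_nhdsWithin).exists
  have hθ0' : 0 < θ := hθ0
  refine ⟨θ, hθ0', hθ1, ?_⟩
  have : slope g 0 θ < 0 := hneg
  rw [slope_def_field, hg0, sub_zero, sub_zero] at this
  have := (div_lt_iff₀ hθ0').1 this
  rwa [zero_mul] at this

variable [IsProbabilityMeasure E]

theorem Subcritical.exp_LamE (hE : Subcritical E) {ρ : ℝ} (hρ : 0 ≤ ρ) :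
    Real.exp (LamE E ρ) = ∫ F, Real.exp (ρ * logMean F) ∂E :=
  exp_cgf (hE.integrable_exp ρ hρ)

theorem Subcritical.LamE_one_neg (hE : Subcritical E) (hα : 1 < alpha E) : LamE E 1 < 0 := by
  obtain ⟨_, ⟨ρ, ⟨hρ0, hρ⟩, rfl⟩, h1ρ⟩ := lt_sSup_iff.1 hα
  have h1ρ' : 1 < ρ := EReal.coe_lt_coe_iff.1 h1ρ
  by_contra hcon
  have hcon' := not_lt.1 hcon
  have hi1 := hE.integrable_exp 1 zero_le_one
  have hiρ := hE.integrable_exp ρ hρ0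
  have h1 : 1 ≤ ∫ F, Real.exp (1 * logMean F) ∂E := by
    rw [← hE.exp_LamE zero_le_one]; exact Real.one_le_exp hcon'
  have h2 : ∫ F, Real.exp (ρ * logMean F) ∂E ≤ 1 := by
    rw [← hE.exp_LamE hρ0]; exact Real.exp_le_one_iff.2 hρ
  -- Bernoulli's inequality for `e ^ X`, an equality only where `X = 0`
  set f : OffspringLaw → ℝ := fun F =>
    Real.exp (ρ * logMean F) - (1 + ρ * (Real.exp (1 * logMean F) - 1)) with hf
  have hlt : ∀ F, logMean F ≠ 0 → 0 < f F := by
    intro F hF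
    have := one_add_mul_self_lt_rpow_one_add (s := Real.exp (1 * logMean F) - 1) (p := ρ)
      (by linarith [Real.exp_pos (1 * logMean F)])
      (by rw [one_mul, sub_ne_zero]; exact fun h => hF (Real.exp_eq_one_iff _ |>.1 h)) h1ρ'
    rw [add_sub_cancel, ← Real.exp_mul, one_mul, mul_comm (logMean F)] at this
    rw [hf]
    simpa using this
  have hnn : 0 ≤ f := by
    intro F
    by_cases hF : logMean F = 0
    · simp [hf, hF]
    · exact (hlt F hF).le
  have hi : Integrable (fun F => ρ * (Real.exp (1 * logMean F) - 1)) E :=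
    (hi1.sub (integrable_const 1)).const_mul ρ
  have hg : Integrable (fun F => 1 + ρ * (Real.exp (1 * logMean F) - 1)) E :=
    (integrable_const 1).add hi
  have hint : ∫ F, f F ∂E = 0 := by
    refine le_antisymm ?_ (integral_nonneg hnn)
    rw [hf, integral_sub hiρ hg, integral_add (integrable_const 1) hi,
      integral_const_mul, integral_sub hi1 (integrable_const 1)]
    simp only [integral_const, probReal_univ, smul_eq_mul, mul_one]
    nlinarith
  have h0 := (integral_eq_zero_iff_of_nonneg hnn (hiρ.sub hg)).1 hint
  have hX : ∫ F, logMean F ∂E = 0 := by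
    refine integral_eq_zero_of_ae (h0.mono fun F hF => ?_)
    by_contra hne
    exact (hlt F hne).ne' hF
  exact hE.integral_logMean_neg.ne hX

theorem Subcritical.lintegral_biasedMean_rpow (hE : Subcritical E) (L : ℝ) {ρ : ℝ} (hρ : 0 ≤ ρ) :
    ∫⁻ F, biasedMean (eexp L) F ^ ρ ∂E = eexp (LamE E ρ - ρ * L) := by
  have h1 : ∀ᵐ F ∂E, biasedMean (eexp L) F ^ ρ =
      eexp (-(ρ * L)) * ENNReal.ofReal (Real.exp (ρ * logMean F)) := by
    filter_upwards [hE.biasedMean_eq L] with F hF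
    rw [hF, eexp_rpow, mul_sub, sub_eq_add_neg, eexp_add, mul_comm]
    rfl
  rw [lintegral_congr_ae h1, lintegral_const_mul' _ _ (eexp_ne_top _),
    ← ofReal_integral_eq_lintegral_ofReal (hE.integrable_exp ρ hρ)
      (ae_of_all _ fun F => Real.exp_nonneg _), ← hE.exp_LamE hρ, sub_eq_add_neg, eexp_add, mul_comm]
  rfl

/-- Convexity of `Λ_e` together with `Λ_e(0) = 0`. -/
theorem Subcritical.mul_LamE_one_le (hE : Subcritical E) {p : ℝ} (hp : 1 ≤ p) :
    p * LamE E 1 ≤ LamE E p := by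
  have hp0 : 0 ≤ p := zero_le_one.trans hp
  set L := LamE E 1 with hL
  have hi1 := hE.integrable_exp 1 zero_le_one
  have hiρ := hE.integrable_exp p hp0
  have h1 : ∀ F, 1 + p * (Real.exp (-L) * Real.exp (1 * logMean F) - 1) ≤
      Real.exp (-(p * L)) * Real.exp (p * logMean F) := by
    intro F
    have := one_add_mul_self_le_rpow_one_add
      (s := Real.exp (-L) * Real.exp (1 * logMean F) - 1) (p := p)
      (by have := Real.exp_pos (-L); have := Real.exp_pos (1 * logMean F); nlinarith) hp
    rw [add_sub_cancel, ← Real.exp_add, ← Real.exp_mul] at this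
    rw [← Real.exp_add, ← Real.exp_add]
    refine this.trans (le_of_eq ?_)
    congr 1; ring
  have hg : Integrable (fun F => p * (Real.exp (-L) * Real.exp (1 * logMean F) - 1)) E :=
    ((hi1.const_mul _).sub (integrable_const 1)).const_mul p
  have h2 := integral_mono ((integrable_const 1).add hg) (hiρ.const_mul (Real.exp (-(p * L)))) h1
  simp only [Pi.add_apply] at h2
  rw [integral_add (integrable_const 1) hg, integral_const_mul,
    integral_sub (hi1.const_mul _) (integrable_const 1), integral_const_mul, integral_const_mul,
    ← hE.exp_LamE hp0, ← hE.exp_LamE zero_le_one, ← hL, ← Real.exp_add, ← Real.exp_add,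
    neg_add_cancel] at h2
  simp only [integral_const, probReal_univ, smul_eq_mul, mul_one, Real.exp_zero, sub_self,
    mul_zero, add_zero] at h2
  have := Real.one_le_exp_iff.1 h2
  linarith

end Exponents

end BRWRE

theorem theorem2
    (E : Measure BRWRE.OffspringLaw) [IsProbabilityMeasure E]
    (μ : Measure ℤ) [IsProbabilityMeasure μ]
    (hE : BRWRE.Subcritical E) (hμ : BRWRE.JumpAssumption μ)
    (hα : 1 < BRWRE.alpha E)
    (lam₁ : ℝ) (hlam_pos : 0 < lam₁) (hlam : BRWRE.LamE E 1 + BRWRE.LamS μ lam₁ = 0)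
    (hΘ : BRWRE.theta1 E μ lam₁ < 0)
    (hη : ∫⁻ F, ENNReal.ofReal (Real.exp (BRWRE.logMean F - BRWRE.LamE E 1)) *
      BRWRE.logPlus (BRWRE.factorialMoment F) ∂E < ∞) :
    BRWRE.LamE E 1 < 0 ∧
    ∃ C₁ : ℝ, 0 < C₁ ∧ C₁ ≤ 1 ∧
      Tendsto (fun x : ℕ => Real.exp (lam₁ * x) *
          (BRWRE.annealed E μ).real {p | ((x : ℝ) : EReal) ≤ BRWRE.maxDisp p.2})
        atTop (𝓝 C₁) := by
  open BRWRE in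
  have hL := hE.LamE_one_neg hα
  refine ⟨hL, ?_⟩
  set L := LamE E 1 with hLdef
  have hS : LamS μ lam₁ = -L := by linarith
  set ν := μ.tilted fun h => lam₁ * (h : ℝ) with hνdef
  have : IsProbabilityMeasure ν := isProbabilityMeasure_tilted (hμ.integrable_exp hlam_pos.le)
  have hν : ∀ᵐ h ∂ν, h ≤ 1 := (tilted_absolutelyContinuous μ _).ae_le hμ.ae_le_one
  have hbias : IsBias μ ν lam₁ (eexp L) := by
    have := hμ.isBias_tilted hlam_pos.le
    rwa [hS, neg_neg] at this
  have ha0 := (eexp_pos L).ne'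
  have ha := eexp_ne_top L
  have hρ : ∫⁻ h, expWeight lam₁ (-h) ∂ν < 1 := by
    rw [hbias.lintegral_expWeight_neg, sub_self]
    simp only [expWeight_zero_left, lintegral_const, measure_univ, mul_one]
    rw [eexp, ENNReal.ofReal_lt_one]
    exact Real.exp_lt_one_iff.2 hL
  have hE1 : ∫⁻ F, biasedMean (eexp L) F ∂E = 1 := by
    have := hE.lintegral_biasedMean_rpow L zero_le_one
    simpa [← hLdef, eexp_zero] using this
  have hlog : ∫⁻ F, biasedMean (eexp L) F * logPlus (factorialMoment F) ∂E < ∞ := by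
    refine lt_of_le_of_lt (le_of_eq (lintegral_congr_ae ?_)) hη
    filter_upwards [hE.biasedMean_eq L] with F hF
    rw [hF]; rfl
  obtain ⟨θ, hθ0, hθ1, hθ⟩ := exists_fractional_exponent hE hμ hlam_pos hlam hΘ
  have hφ : 1 ≤ ∫⁻ F, biasedMean (eexp L) F ^ (1 + θ) ∂E := by
    rw [hE.lintegral_biasedMean_rpow L (by linarith), ← eexp_zero]
    refine eexp_mono ?_
    have := hE.mul_LamE_one_le (p := 1 + θ) (by linarith)
    linarith
  have hφψ : (∫⁻ F, biasedMean (eexp L) F ^ (1 + θ) ∂E) *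
      ∫⁻ h, expWeight (θ * lam₁) (-h) ∂ν < 1 := by
    rw [hE.lintegral_biasedMean_rpow L (by linarith), hbias.lintegral_expWeight_neg,
      hμ.lintegral_expWeight (by nlinarith), ← eexp_add, ← eexp_add, eexp,
      ENNReal.ofReal_lt_one]
    exact Real.exp_lt_one_iff.2 hθ
  obtain ⟨κ, hκ, hκle⟩ := le_iSup_lintegral_normHit hν hlam_pos.le hρ hbias ha0 ha hE1
    hE.mean_pos_finite hlog hθ0 hθ1 hφ hφψ
  set A : ℤ → ℝ≥0∞ := fun x => ⨆ N, ∫⁻ e, normHit μ lam₁ N e x ∂futureLaw E with hA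
  have hAeq : ∀ x : ℕ, Real.exp (lam₁ * x) *
      (annealed E μ).real {p | ((x : ℝ) : EReal) ≤ maxDisp p.2} = (A x).toReal := by
    intro x
    have h1 : A x = expWeight lam₁ x * annealed E μ {p | ((x : ℝ) : EReal) ≤ maxDisp p.2} := by
      have h2 := annealed_le_maxDisp E μ x
      simp only [Int.cast_natCast] at h2
      rw [h2, ENNReal.mul_iSup]
      exact iSup_congr fun N => lintegral_const_mul _ (measurable_hitProb N _)
    rw [h1, ENNReal.toReal_mul, expWeight, ENNReal.toReal_ofReal (Real.exp_nonneg _)]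
    simp [Measure.real]
  have hA0 : A 0 = 1 := by
    simp [hA, normHit_of_nonpos, expWeight_zero_right]
  have hanti : ∀ x z : ℕ, x ≤ z → A z ≤ A x := fun x z hxz => iSup_le fun N =>
    lintegral_normHit_le_iSup hν hbias ha0 ha hE1 (Int.natCast_nonneg x)
      (by exact_mod_cast hxz) N
  have hA1 : ∀ x : ℕ, A x ≤ 1 := fun x => by
    have := hanti 0 x (Nat.zero_le x)
    rwa [Nat.cast_zero, hA0] at this
  have hAtop : ∀ x : ℕ, A x ≠ ∞ := fun x => ((hA1 x).trans_lt ENNReal.one_lt_top).ne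
  have hκx : ∀ x : ℕ, κ ≤ A x := fun x => hκle x (Int.natCast_nonneg x)
  have hκtop : κ ≠ ∞ := ne_top_of_le_ne_top (hAtop 0) (hκx 0)
  simp_rw [hAeq]
  have hlow : ∀ x : ℕ, κ.toReal ≤ (A x).toReal := fun x =>
    ENNReal.toReal_mono (hAtop x) (hκx x)
  have hbdd : BddBelow (Set.range fun x : ℕ => (A x).toReal) :=
    ⟨κ.toReal, by rintro _ ⟨x, rfl⟩; exact hlow x⟩
  refine ⟨⨅ x : ℕ, (A x).toReal, ?_, ?_, tendsto_atTop_ciInf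
    (fun x z hxz => ENNReal.toReal_mono (hAtop x) (hanti x z hxz)) hbdd⟩
  · exact (ENNReal.toReal_pos hκ.ne' hκtop).trans_le (le_ciInf hlow)
  · refine (ciInf_le hbdd 0).trans ?_
    rw [Nat.cast_zero, hA0, ENNReal.toReal_one]
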